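/- Let $M$ be a connected smooth 3-dimensional manifold with a contact metric structure $(\eta,\xi,\phi,g)$: $\eta$ is a contact form (that is, $\eta\wedge d\eta$ vanishes nowhere), $g$ is a Riemannian metric, $\xi$ is a unit vector field and $\phi$ is an endomorphism of the tangent bundle, all smooth, such that $$\eta(\xi)=1,\qquad \phi^2=-\mathrm{Id}+\eta\otimes\xi,\qquad \phi\xi=0,\qquad d\eta(X,Y)=2g(X,\phi Y),$$ where $d\eta(X,Y)=X(\eta(Y))-Y(\eta(X))-\eta([X,Y])$. Let $Q$ be the Ricci operator of $g$, defined by $g(QX,Y)=\mathrm{Ric}(X,Y)$. Suppose that the structure is generalized Eta-Einstein, that is, there are smooth functions $\lambda,\gamma:M\to\mathbb{R}$ with $$QX=\lambda X+\gamma\,\eta(X)\,\xi\qquad\text{for all tangent vectors } X,$$ and that it is not K-contact, that is, $\xi$ is not a Killing vector field of $g$. Then $\lambda=0$ identically and $\gamma$ is constant, so that $QX=\gamma\,\eta(X)\,\xi$ for all tangent vectors $X$ with a constant $\gamma$. In particular, the scalar curvature of $(M,g)$ is the constant $\gamma$. -/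

import Mathlib

open Bundle VectorField FiberBundle
open scoped Manifold ContDiff

noncomputable section

namespace ContactGeometry

section General

variable {E : Type*} [NormedAddCommGroup E] [NormedSpace ℝ E]
  {H : Type*} [TopologicalSpace H] (I : ModelWithCorners ℝ E H)
  {M : Type*} [TopologicalSpace M] [ChartedSpace H M]

/-- The exterior derivative of a one-form on vector fields, with the convention
`dη(X, Y) = X(η(Y)) - Y(η(X)) - η([X, Y])` (no factor `1/2`). -/
def extDerivOnFields (η : Π x : M, TangentSpace I x →L[ℝ] ℝ)
    (X Y : Π x : M, TangentSpace I x) (x : M) : ℝ :=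
  d% (fun y ↦ η y (Y y)) x (X x) - d% (fun y ↦ η y (X y)) x (Y x) - η x (mlieBracket I X Y x)

section Riemannian

variable [RiemannianBundle (fun x : M ↦ TangentSpace I x)]

/-- The right-hand side of Koszul's formula, i.e. the value of `g(∇_X Y, Z)` at `x`. -/
def koszul (X Y Z : Π x : M, TangentSpace I x) (x : M) : ℝ :=
  (d% (fun y ↦ inner ℝ (Y y) (Z y)) x (X x)
    + d% (fun y ↦ inner ℝ (Z y) (X y)) x (Y x)
    - d% (fun y ↦ inner ℝ (X y) (Y y)) x (Z x)
    + inner ℝ (mlieBracket I X Y x) (Z x)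
    - inner ℝ (mlieBracket I Y Z x) (X x)
    + inner ℝ (mlieBracket I Z X x) (Y x)) / 2

variable [IsManifold I ∞ M] [IsContMDiffRiemannianBundle I ∞ E (fun x : M ↦ TangentSpace I x)]

variable {I} {x : M} {f : M → ℝ} {X X' Y Y' Z Z' : Π x : M, TangentSpace I x}

theorem mdifferentiableAt_inner (hX : MDiffAt (T% X) x) (hY : MDiffAt (T% Y) x) :
    MDiffAt (fun y ↦ (inner ℝ (X y) (Y y) : ℝ)) x :=
  MDifferentiableAt.inner_bundle (F := E) (E := fun x : M ↦ TangentSpace I x) (b := id) hX hY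

theorem mvfderiv_inner_smul_left
    (hf : MDiffAt f x) (hX : MDiffAt (T% X) x) (hY : MDiffAt (T% Y) x) :
    d% (fun y ↦ (inner ℝ ((f • X) y) (Y y) : ℝ)) x
      = f x • d% (fun y ↦ (inner ℝ (X y) (Y y) : ℝ)) x + (inner ℝ (X x) (Y x) : ℝ) • d% f x := by
  simp only [Pi.smul_apply', real_inner_smul_left]
  exact mvfderiv_fun_mul hf (mdifferentiableAt_inner hX hY)

theorem mvfderiv_inner_smul_right
    (hf : MDiffAt f x) (hX : MDiffAt (T% X) x) (hY : MDiffAt (T% Y) x) :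
    d% (fun y ↦ (inner ℝ (X y) ((f • Y) y) : ℝ)) x
      = f x • d% (fun y ↦ (inner ℝ (X y) (Y y) : ℝ)) x + (inner ℝ (X x) (Y x) : ℝ) • d% f x := by
  simp only [Pi.smul_apply', real_inner_smul_right]
  exact mvfderiv_fun_mul hf (mdifferentiableAt_inner hX hY)

theorem mvfderiv_inner_add_left
    (hX : MDiffAt (T% X) x) (hX' : MDiffAt (T% X') x) (hY : MDiffAt (T% Y) x) :
    d% (fun y ↦ (inner ℝ ((X + X') y) (Y y) : ℝ)) x
      = d% (fun y ↦ (inner ℝ (X y) (Y y) : ℝ)) x + d% (fun y ↦ (inner ℝ (X' y) (Y y) : ℝ)) x := by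
  simp only [Pi.add_apply, inner_add_left]
  exact mvfderiv_fun_add (mdifferentiableAt_inner hX hY) (mdifferentiableAt_inner hX' hY)

theorem mvfderiv_inner_add_right
    (hX : MDiffAt (T% X) x) (hY : MDiffAt (T% Y) x) (hY' : MDiffAt (T% Y') x) :
    d% (fun y ↦ (inner ℝ (X y) ((Y + Y') y) : ℝ)) x
      = d% (fun y ↦ (inner ℝ (X y) (Y y) : ℝ)) x + d% (fun y ↦ (inner ℝ (X y) (Y' y) : ℝ)) x := by
  simp only [Pi.add_apply, inner_add_right]
  exact mvfderiv_fun_add (mdifferentiableAt_inner hX hY) (mdifferentiableAt_inner hX hY')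

variable [CompleteSpace E]

theorem koszul_smul₁ (hf : MDiffAt f x) (hX : MDiffAt (T% X) x) (hY : MDiffAt (T% Y) x)
    (hZ : MDiffAt (T% Z) x) : koszul I (f • X) Y Z x = f x * koszul I X Y Z x := by
  rw [koszul, koszul, mvfderiv_inner_smul_right hf hZ hX, mvfderiv_inner_smul_left hf hX hY,
    mlieBracket_smul_left hf hX, mlieBracket_smul_right hf hX]
  simp [inner_add_left, real_inner_smul_left, real_inner_smul_right]
  rw [real_inner_comm (X x) (Z x)]
  ring

theorem koszul_smul₂ (hf : MDiffAt f x) (hX : MDiffAt (T% X) x) (hY : MDiffAt (T% Y) x)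
    (hZ : MDiffAt (T% Z) x) : koszul I X (f • Y) Z x
      = f x * koszul I X Y Z x + d% f x (X x) * inner ℝ (Y x) (Z x) := by
  rw [koszul, koszul, mvfderiv_inner_smul_right hf hX hY, mvfderiv_inner_smul_left hf hY hZ,
    mlieBracket_smul_left hf hY, mlieBracket_smul_right hf hY]
  simp [inner_add_left, real_inner_smul_left, real_inner_smul_right]
  rw [real_inner_comm (X x) (Y x)]
  ring

theorem koszul_smul₃ (hf : MDiffAt f x) (hX : MDiffAt (T% X) x) (hY : MDiffAt (T% Y) x)
    (hZ : MDiffAt (T% Z) x) : koszul I X Y (f • Z) x = f x * koszul I X Y Z x := by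
  rw [koszul, koszul, mvfderiv_inner_smul_right hf hY hZ, mvfderiv_inner_smul_left hf hZ hX,
    mlieBracket_smul_left hf hZ, mlieBracket_smul_right hf hZ]
  simp [inner_add_left, real_inner_smul_left, real_inner_smul_right]
  rw [real_inner_comm (Y x) (Z x)]
  ring

theorem koszul_add₁ (hX : MDiffAt (T% X) x) (hX' : MDiffAt (T% X') x) (hY : MDiffAt (T% Y) x)
    (hZ : MDiffAt (T% Z) x) :
    koszul I (X + X') Y Z x = koszul I X Y Z x + koszul I X' Y Z x := by
  rw [koszul, koszul, koszul, mvfderiv_inner_add_right hZ hX hX', mvfderiv_inner_add_left hX hX' hY,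
    mlieBracket_add_left hX hX', mlieBracket_add_right hX hX']
  simp [inner_add_left, inner_add_right]
  ring

theorem koszul_add₂ (hX : MDiffAt (T% X) x) (hY : MDiffAt (T% Y) x) (hY' : MDiffAt (T% Y') x)
    (hZ : MDiffAt (T% Z) x) :
    koszul I X (Y + Y') Z x = koszul I X Y Z x + koszul I X Y' Z x := by
  rw [koszul, koszul, koszul, mvfderiv_inner_add_right hX hY hY', mvfderiv_inner_add_left hY hY' hZ,
    mlieBracket_add_left hY hY', mlieBracket_add_right hY hY']
  simp [inner_add_left, inner_add_right]
  ring

theorem koszul_add₃ (hX : MDiffAt (T% X) x) (hY : MDiffAt (T% Y) x) (hZ : MDiffAt (T% Z) x)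
    (hZ' : MDiffAt (T% Z') x) :
    koszul I X Y (Z + Z') x = koszul I X Y Z x + koszul I X Y Z' x := by
  rw [koszul, koszul, koszul, mvfderiv_inner_add_right hY hZ hZ', mvfderiv_inner_add_left hZ hZ' hX,
    mlieBracket_add_left hZ hZ', mlieBracket_add_right hZ hZ']
  simp [inner_add_left, inner_add_right]
  ring

end Riemannian

section LeviCivita

variable [RiemannianBundle (fun x : M ↦ TangentSpace I x)] [FiniteDimensional ℝ E]
  [IsManifold I ∞ M] [IsContMDiffRiemannianBundle I ∞ E (fun x : M ↦ TangentSpace I x)]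

instance (x : M) : FiniteDimensional ℝ (TangentSpace I x) :=
  inferInstanceAs (FiniteDimensional ℝ E)

variable {I}

/-- Koszul's formula at `x`, for `Y` differentiable at `x`, as a bilinear form in the values at `x`
of `X` and `Z`. -/
def koszulForm (Y : Π x : M, TangentSpace I x) (x : M) (hY : MDiffAt (T% Y) x) :
    TangentSpace I x →L[ℝ] TangentSpace I x →L[ℝ] ℝ :=
  have : CompleteSpace E := FiniteDimensional.complete ℝ E
  TensorialAt.mkHom₂ (I := I) (F := E) (F' := E) (fun X Z ↦ koszul I X Y Z x) x
    (fun _ hZ ↦ ⟨fun hf hX ↦ koszul_smul₁ hf hX hY hZ, fun hX hX' ↦ koszul_add₁ hX hX' hY hZ⟩)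
    (fun _ hX ↦ ⟨fun hf hZ ↦ koszul_smul₃ hf hX hY hZ, fun hZ hZ' ↦ koszul_add₃ hX hY hZ hZ'⟩)

theorem koszulForm_apply {X Y Z : Π x : M, TangentSpace I x} {x : M} (hX : MDiffAt (T% X) x)
    (hY : MDiffAt (T% Y) x) (hZ : MDiffAt (T% Z) x) :
    koszulForm Y x hY (X x) (Z x) = koszul I X Y Z x :=
  TensorialAt.mkHom₂_apply _ _ hX hZ

open scoped Classical in
/-- `∇_v Y` at `x` for the Levi-Civita connection: the vector whose inner product with each
tangent vector is given by Koszul's formula (and `0` if `Y` is not differentiable at `x`). -/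
def leviCivitaFun (Y : Π x : M, TangentSpace I x) (x : M) :
    TangentSpace I x →L[ℝ] TangentSpace I x :=
  have : CompleteSpace (TangentSpace I x) := FiniteDimensional.complete ℝ (TangentSpace I x)
  if hY : MDiffAt (T% Y) x then
    (InnerProductSpace.toDual ℝ
      (TangentSpace I x)).symm.toContinuousLinearEquiv.toContinuousLinearMap ∘L koszulForm Y x hY
  else 0

theorem inner_leviCivitaFun {X Y Z : Π x : M, TangentSpace I x} {x : M} (hX : MDiffAt (T% X) x)
    (hY : MDiffAt (T% Y) x) (hZ : MDiffAt (T% Z) x) :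
    inner ℝ (leviCivitaFun Y x (X x)) (Z x) = koszul I X Y Z x := by
  have : CompleteSpace (TangentSpace I x) := FiniteDimensional.complete ℝ (TangentSpace I x)
  rw [← koszulForm_apply hX hY hZ, leviCivitaFun, dif_pos hY]
  simp

variable (I M) in
/-- The Levi-Civita connection of the Riemannian metric of `M`. Here `leviCivita I M Y x (X x)` is
the value at `x` of `∇_X Y`. -/
def leviCivita : CovariantDerivative I E (TangentSpace I : M → Type _) where
  toFun := leviCivitaFun
  isCovariantDerivativeOnUniv :=
    { add := by
        intro Y Y' x hY hY' _
        have : CompleteSpace E := FiniteDimensional.complete ℝ E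
        have hYY' := mdifferentiableAt_add_section hY hY'
        ext v
        refine ext_inner_right ℝ fun w ↦ ?_
        have hv := mdifferentiableAt_extend I E v
        have hw := mdifferentiableAt_extend I E w
        have h := inner_leviCivitaFun hv hYY' hw
        have h1 := inner_leviCivitaFun hv hY hw
        have h2 := inner_leviCivitaFun hv hY' hw
        rw [koszul_add₂ hv hY hY' hw, ← h1, ← h2, extend_apply_self, extend_apply_self] at h
        rw [h, add_apply, inner_add_left]
      leibniz := by
        intro Y f x hY hf _
        have : CompleteSpace E := FiniteDimensional.complete ℝ E
        have hfY := hf.smul_section hY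
        ext v
        refine ext_inner_right ℝ fun w ↦ ?_
        have hv := mdifferentiableAt_extend I E v
        have hw := mdifferentiableAt_extend I E w
        have h := inner_leviCivitaFun hv hfY hw
        have h1 := inner_leviCivitaFun hv hY hw
        rw [koszul_smul₂ hf hv hY hw, ← h1, extend_apply_self, extend_apply_self] at h
        rw [h, add_apply, inner_add_left, smul_apply,
          ContinuousLinearMap.smulRight_apply, real_inner_smul_left, real_inner_smul_left] }

theorem inner_leviCivita {X Y Z : Π x : M, TangentSpace I x} {x : M} (hX : MDiffAt (T% X) x)
    (hY : MDiffAt (T% Y) x) (hZ : MDiffAt (T% Z) x) :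
    inner ℝ (leviCivita I M Y x (X x)) (Z x) = koszul I X Y Z x :=
  inner_leviCivitaFun hX hY hZ

/-- The Levi-Civita connection is torsion-free. -/
theorem leviCivita_torsion : (leviCivita I M).torsion = 0 := by
  have : CompleteSpace E := FiniteDimensional.complete ℝ E
  rw [CovariantDerivative.torsion_eq_zero_iff]
  intro X Y x hX hY
  refine ext_inner_right ℝ fun w ↦ ?_
  have hw := mdifferentiableAt_extend I E w
  have h1 := inner_leviCivita hX hY hw
  have h2 := inner_leviCivita hY hX hw
  have hc (U V : Π x : M, TangentSpace I x) :
      (fun y ↦ (inner ℝ (U y) (V y) : ℝ)) = fun y ↦ inner ℝ (V y) (U y) := by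
    ext y; exact real_inner_comm _ _
  rw [extend_apply_self] at h1 h2
  rw [inner_sub_left, h1, h2, koszul, koszul, mlieBracket_swap_apply (V := Y) (W := X),
    mlieBracket_swap_apply (V := extend E w) (W := X),
    mlieBracket_swap_apply (V := extend E w) (W := Y), extend_apply_self, hc X Y,
    hc (extend E w) Y, hc (extend E w) X]
  simp only [inner_neg_left]
  ring

/-- The Levi-Civita connection is compatible with the metric. -/
theorem leviCivita_metric {X Y Z : Π x : M, TangentSpace I x} {x : M} (hX : MDiffAt (T% X) x)
    (hY : MDiffAt (T% Y) x) (hZ : MDiffAt (T% Z) x) :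
    d% (fun y ↦ (inner ℝ (Y y) (Z y) : ℝ)) x (X x)
      = inner ℝ (leviCivita I M Y x (X x)) (Z x) + inner ℝ (Y x) (leviCivita I M Z x (X x)) := by
  have hc (U V : Π x : M, TangentSpace I x) :
      (fun y ↦ (inner ℝ (U y) (V y) : ℝ)) = fun y ↦ inner ℝ (V y) (U y) := by
    ext y; exact real_inner_comm _ _
  rw [real_inner_comm _ (Y x), inner_leviCivita hX hY hZ, inner_leviCivita hX hZ hY,
    koszul, koszul, mlieBracket_swap_apply (V := Y) (W := X),
    mlieBracket_swap_apply (V := Z) (W := X), mlieBracket_swap_apply (V := Z) (W := Y),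
    hc Z Y, hc Z X, hc Y X]
  simp only [inner_neg_left]
  ring

variable (I)

/-- The curvature `R(X, Y)Z = ∇_X ∇_Y Z - ∇_Y ∇_X Z - ∇_[X,Y] Z` of vector fields. -/
def curvatureOnFields (X Y Z : Π x : M, TangentSpace I x) (x : M) : TangentSpace I x :=
  leviCivita I M (fun y ↦ leviCivita I M Z y (Y y)) x (X x)
    - leviCivita I M (fun y ↦ leviCivita I M Z y (X y)) x (Y x)
    - leviCivita I M Z x (mlieBracket I X Y x)

/-- The curvature `R(u, v)w` of tangent vectors at `x`. Since `R` is a tensor, it is computed with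
the vector fields that extend `u`, `v`, `w` and have constant components in the preferred
trivialization of the tangent bundle at `x`; these are smooth near `x`. -/
def curvature (x : M) (u v w : TangentSpace I x) : TangentSpace I x :=
  curvatureOnFields I (extend E u) (extend E v) (extend E w) x

/-- The Ricci tensor `Ric(v, w)`, the trace of `u ↦ R(u, v)w`, computed in an orthonormal basis. -/
def ricci (x : M) (v w : TangentSpace I x) : ℝ :=
  ∑ i, inner ℝ (curvature I x (stdOrthonormalBasis ℝ (TangentSpace I x) i) v w)
    (stdOrthonormalBasis ℝ (TangentSpace I x) i)

/-- The Ricci operator `Q`, determined by `g(Qv, w) = Ric(v, w)`. -/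
def ricciOperator (x : M) (v : TangentSpace I x) : TangentSpace I x :=
  ∑ i, ricci I x v (stdOrthonormalBasis ℝ (TangentSpace I x) i) •
    stdOrthonormalBasis ℝ (TangentSpace I x) i

/-- The scalar curvature, the trace of the Ricci tensor. -/
def scalarCurvature (x : M) : ℝ :=
  ∑ i, ricci I x (stdOrthonormalBasis ℝ (TangentSpace I x) i)
    (stdOrthonormalBasis ℝ (TangentSpace I x) i)

/-- A vector field `V` is Killing (an infinitesimal isometry) if `L_V g = 0`, that is
`V(g(X, Y)) = g([V, X], Y) + g(X, [V, Y])` for all vector fields `X`, `Y`. -/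
def IsKilling (V : Π x : M, TangentSpace I x) : Prop :=
  ∀ (x : M) (X Y : Π x : M, TangentSpace I x), MDiffAt (T% X) x → MDiffAt (T% Y) x →
    d% (fun y ↦ (inner ℝ (X y) (Y y) : ℝ)) x (V x)
      = inner ℝ (mlieBracket I V X x) (Y x) + inner ℝ (X x) (mlieBracket I V Y x)

end LeviCivita

end General

section Contact

variable (M : Type*) [TopologicalSpace M] [ChartedSpace (EuclideanSpace ℝ (Fin 3)) M]

variable {M} in
/-- A one-form `η` on a 3-manifold is a contact form if `η ∧ dη` vanishes nowhere. -/
def IsContactForm [IsManifold (𝓡 3) ∞ M]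
    (η : Π x : M, TangentSpace (𝓡 3) x →L[ℝ] ℝ) : Prop :=
  ∀ x : M, ∃ X Y Z : Π x : M, TangentSpace (𝓡 3) x,
    MDifferentiableAt (𝓡 3) (𝓡 3).tangent (T% X) x ∧
    MDifferentiableAt (𝓡 3) (𝓡 3).tangent (T% Y) x ∧
    MDifferentiableAt (𝓡 3) (𝓡 3).tangent (T% Z) x ∧
    η x (X x) * extDerivOnFields (𝓡 3) η Y Z x + η x (Y x) * extDerivOnFields (𝓡 3) η Z X x
      + η x (Z x) * extDerivOnFields (𝓡 3) η X Y x ≠ 0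

/-- A contact metric structure `(η, ξ, φ, g)` on a 3-manifold `M` with Riemannian metric `g`:
`η` is a contact form, `ξ` a unit vector field, `φ` an endomorphism of the tangent bundle, with
`η(ξ) = 1`, `φ² = -Id + η ⊗ ξ`, `φξ = 0` and `dη(X, Y) = 2 g(X, φY)`; all data are smooth. -/
structure ContactMetricStructure [IsManifold (𝓡 3) ∞ M]
    [RiemannianBundle (fun x : M ↦ TangentSpace (𝓡 3) x)] where
  η : Π x : M, TangentSpace (𝓡 3) x →L[ℝ] ℝ
  ξ : Π x : M, TangentSpace (𝓡 3) x
  φ : Π x : M, TangentSpace (𝓡 3) x →L[ℝ] TangentSpace (𝓡 3) x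
  contMDiff_η : ContMDiff (𝓡 3) ((𝓡 3).prod 𝓘(ℝ, EuclideanSpace ℝ (Fin 3) →L[ℝ] ℝ)) ∞
    (fun x ↦ TotalSpace.mk' (EuclideanSpace ℝ (Fin 3) →L[ℝ] ℝ)
      (E := fun x : M ↦ TangentSpace (𝓡 3) x →L[ℝ] ℝ) x (η x))
  contMDiff_ξ : ContMDiff (𝓡 3) (𝓡 3).tangent ∞ (T% ξ)
  contMDiff_φ : ContMDiff (𝓡 3)
    ((𝓡 3).prod 𝓘(ℝ, EuclideanSpace ℝ (Fin 3) →L[ℝ] EuclideanSpace ℝ (Fin 3))) ∞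
    (fun x ↦ TotalSpace.mk' (EuclideanSpace ℝ (Fin 3) →L[ℝ] EuclideanSpace ℝ (Fin 3))
      (E := fun x : M ↦ TangentSpace (𝓡 3) x →L[ℝ] TangentSpace (𝓡 3) x) x (φ x))
  isContactForm : IsContactForm η
  norm_ξ : ∀ x, ‖ξ x‖ = 1
  η_ξ : ∀ x, η x (ξ x) = 1
  φ_φ : ∀ x v, φ x (φ x v) = -v + η x v • ξ x
  φ_ξ : ∀ x, φ x (ξ x) = 0
  extDeriv_η : ∀ (x : M) (X Y : Π x : M, TangentSpace (𝓡 3) x),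
    MDifferentiableAt (𝓡 3) (𝓡 3).tangent (T% X) x →
    MDifferentiableAt (𝓡 3) (𝓡 3).tangent (T% Y) x →
    extDerivOnFields (𝓡 3) η X Y x = 2 * inner ℝ (X x) (φ x (Y x))

variable {M} [IsManifold (𝓡 3) ∞ M] [RiemannianBundle (fun x : M ↦ TangentSpace (𝓡 3) x)]

/-- A contact metric structure is K-contact if its Reeb field is an infinitesimal isometry. -/
def ContactMetricStructure.IsKContact (S : ContactMetricStructure M) : Prop :=
  IsKilling (𝓡 3) S.ξ

/-- A contact metric structure is generalized Eta-Einstein, with coefficient functions `lam` and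
`γ`, if these are smooth and the Ricci operator is `Q = lam Id + γ η ⊗ ξ`. -/
def ContactMetricStructure.IsGeneralizedEtaEinsteinWith
    [IsContMDiffRiemannianBundle (𝓡 3) ∞ (EuclideanSpace ℝ (Fin 3))
      (fun x : M ↦ TangentSpace (𝓡 3) x)]
    (S : ContactMetricStructure M) (lam γ : M → ℝ) : Prop :=
  ContMDiff (𝓡 3) 𝓘(ℝ, ℝ) ∞ lam ∧ ContMDiff (𝓡 3) 𝓘(ℝ, ℝ) ∞ γ ∧
    ∀ (x : M) (v : TangentSpace (𝓡 3) x),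
      ricciOperator (𝓡 3) x v = lam x • v + (γ x * S.η x v) • S.ξ x

end Contact

end ContactGeometry

end

/-! Work in a local orthonormal frame `(e₀, e₁ = φ e₀, e₂ = ξ)`. The identity `dη = 2 g(·, φ ·)`
forces `∇ξ = -φ - φ h`. Here `h` vanishes on `ξ` and acts on the contact plane as a symmetric
trace-free matrix with entries `p`, `q`, and the only other connection datum is the form `α(X) =
g(∇_X e₀, e₁)`. Put `f = p + i q` and `D = d + 2 i α`; then `D` is a metric connection for which `f`
is a section.

The Ricci hypothesis becomes (`structure_equations`): `D_ξ f = 0`; `D₁ f = -i D₀ f`; `dα(e₀, ξ) =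
dα(e₁, ξ) = 0`; `dα(e₀, e₁) = -lam`; and `lam + γ = 2 (1 - |f|²)`. Since `D` has no curvature in the
planes containing `ξ`, commuting `D_ξ` with `D₀` and with `D₁ = -i D₀` yields two expressions for
`D_ξ D₀ f`. They agree only if the conjugate of `f` times `D₀ f` is zero (`frameDeriv_zero_eq`). So
`D f = 0` wherever `h ≠ 0` (`frameDeriv_eq`).

A nonzero parallel section kills the remaining curvature, so `lam = 0` there (`lam_eq_zero`), and
`|f|` is locally constant, hence so is `lam + γ` (`mvfderiv_add_eq_zero`). If `lam + γ` were
identically `2`, then `h = 0` and `ξ` would be Killing (`isKContact_of_add_eq_two`). Otherwise a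
level set of `lam + γ` at a value other than `2` is nonempty, closed and open, so it is all of `M`;
thus `h` vanishes nowhere and the local conclusions hold everywhere. -/

noncomputable section

open Filter Topology

namespace ContactGeometry

/-! ### Smooth functions, vector fields and Lie brackets on an open set -/

section Frame

variable {E : Type*} [NormedAddCommGroup E] [NormedSpace ℝ E]
  {H : Type*} [TopologicalSpace H] {I : ModelWithCorners ℝ E H}
  {M : Type*} [TopologicalSpace M] [ChartedSpace H M]

variable (I) in
/-- A real function that is smooth at every point of `U`. -/
def SmoothFunOn (U : Set M) (f : M → ℝ) : Prop :=
  ∀ x ∈ U, ContMDiffAt I 𝓘(ℝ, ℝ) ∞ f x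

theorem minSmoothness_two_le_infty : minSmoothness ℝ 2 ≤ ∞ := by
  rw [minSmoothness_of_isRCLikeNormedField]
  exact WithTop.coe_le_coe.2 le_top

theorem minSmoothness_three_le_infty : minSmoothness ℝ 3 ≤ ∞ := by
  rw [minSmoothness_of_isRCLikeNormedField]
  exact WithTop.coe_le_coe.2 le_top

variable {U : Set M} {f g : M → ℝ} {X Y Z : Π x : M, TangentSpace I x} {x : M}

theorem SmoothFunOn.mdiffAt (hf : SmoothFunOn I U f) (hx : x ∈ U) : MDiffAt f x :=
  (hf x hx).mdifferentiableAt (by simp)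

theorem SmoothFunOn.add (hf : SmoothFunOn I U f) (hg : SmoothFunOn I U g) :
    SmoothFunOn I U (fun y ↦ f y + g y) := fun x hx ↦ (hf x hx).add (hg x hx)

theorem SmoothFunOn.sub (hf : SmoothFunOn I U f) (hg : SmoothFunOn I U g) :
    SmoothFunOn I U (fun y ↦ f y - g y) := fun x hx ↦ (hf x hx).sub (hg x hx)

theorem SmoothFunOn.mul (hf : SmoothFunOn I U f) (hg : SmoothFunOn I U g) :
    SmoothFunOn I U (fun y ↦ f y * g y) := fun x hx ↦ (hf x hx).mul (hg x hx)

theorem SmoothFunOn.const (c : ℝ) : SmoothFunOn I U (fun _ ↦ c) :=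
  fun _ _ ↦ contMDiffAt_const

theorem mvfderiv_congr (h : f =ᶠ[𝓝 x] g) : d% f x = d% g x := by
  ext v
  simp only [mvfderiv, h.mfderiv_eq]
  rfl

theorem mvfderiv_eq_zero_of_eventuallyEq_const {c : ℝ} (h : ∀ᶠ y in 𝓝 x, f y = c) :
    d% f x = 0 := by
  rw [mvfderiv_congr (g := fun _ ↦ c) h, mvfderiv_const]

variable [IsManifold I ∞ M]

/-- A vector field that is smooth at every point of `U`. -/
def SmoothFieldOn (U : Set M) (X : Π x : M, TangentSpace I x) : Prop :=
  ∀ x ∈ U, ContMDiffAt I I.tangent ∞ (T% X) x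

theorem SmoothFieldOn.mdiffAt (hX : SmoothFieldOn U X) (hx : x ∈ U) : MDiffAt (T% X) x :=
  (hX x hx).mdifferentiableAt (by simp)

theorem SmoothFieldOn.add (hX : SmoothFieldOn U X) (hY : SmoothFieldOn U Y) :
    SmoothFieldOn U (X + Y) := fun x hx ↦ (hX x hx).add_section (hY x hx)

theorem SmoothFieldOn.sub (hX : SmoothFieldOn U X) (hY : SmoothFieldOn U Y) :
    SmoothFieldOn U (X - Y) := fun x hx ↦ (hX x hx).sub_section (hY x hx)

theorem SmoothFieldOn.smul (hf : SmoothFunOn I U f) (hX : SmoothFieldOn U X) :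
    SmoothFieldOn U (f • X) := fun x hx ↦ (hf x hx).smul_section (hX x hx)

theorem SmoothFieldOn.mlieBracket [CompleteSpace E]
    (hX : SmoothFieldOn U X) (hY : SmoothFieldOn U Y) :
    SmoothFieldOn U (mlieBracket I X Y) := fun x hx ↦ by
  have : IsManifold I (minSmoothness ℝ 2) M := .of_le (n := ∞) minSmoothness_two_le_infty
  have : IsManifold I (((⊤ : ℕ∞) : ℕ∞ω) + 1) M := ‹IsManifold I ∞ M›
  exact ContMDiffAt.mlieBracket_vectorField (m := ⊤) (n := ⊤) (hX x hx) (hY x hx)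
    (by rw [minSmoothness_of_isRCLikeNormedField]; exact le_rfl)

theorem SmoothFieldOn.congr (hU : IsOpen U) (hX : SmoothFieldOn U X) (h : ∀ y ∈ U, Y y = X y) :
    SmoothFieldOn U Y := fun x hx ↦ by
  refine (hX x hx).congr_of_eventuallyEq ?_
  filter_upwards [hU.mem_nhds hx] with y hy
  rw [h y hy]

theorem SmoothFieldOn.mono {V : Set M} (hX : SmoothFieldOn U X) (h : V ⊆ U) : SmoothFieldOn V X :=
  fun x hx ↦ hX x (h hx)

theorem exists_smoothFieldOn_extend [FiniteDimensional ℝ E] (v : TangentSpace I x) :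
    ∃ U : Set M, IsOpen U ∧ x ∈ U ∧ SmoothFieldOn U (extend E v) := by
  obtain ⟨s, hs, h⟩ := exists_contMDiffOn_extend (k := ∞) I E v
  obtain ⟨U, hUs, hU, hx⟩ := mem_nhds_iff.1 hs
  exact ⟨U, hU, hx, fun y hy ↦ (h y (hUs hy)).contMDiffAt (mem_of_superset (hU.mem_nhds hy) hUs)⟩

/-- The commutator of the derivations given by two vector fields is the derivation given by
their Lie bracket. -/
theorem mvfderiv_mlieBracket [CompleteSpace E] [FiniteDimensional ℝ E] (hU : IsOpen U) (hx : x ∈ U)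
    (hX : SmoothFieldOn U X) (hY : SmoothFieldOn U Y) (hf : SmoothFunOn I U f)
    (hYf : SmoothFunOn I U (fun y ↦ d% f y (Y y))) (hXf : SmoothFunOn I U (fun y ↦ d% f y (X y))) :
    d% f x (mlieBracket I X Y x)
      = d% (fun y ↦ d% f y (Y y)) x (X x) - d% (fun y ↦ d% f y (X y)) x (Y x) := by
  -- The identity is read off as the coefficient of a nonzero vector `w`; if the tangent space is
  -- zero, both sides vanish.
  by_cases hT : ∃ w : TangentSpace I x, w ≠ 0
  swap
  · push Not at hT
    rw [hT (mlieBracket I X Y x), hT (X x), hT (Y x)]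
    simp
  obtain ⟨w, hw⟩ := hT
  obtain ⟨V, hV, hxV, hW⟩ := exists_smoothFieldOn_extend w
  set W := extend E w
  have hWx : W x = w := extend_apply_self E w
  have key (A B : Π x : M, TangentSpace I x) (hA : SmoothFieldOn U A) (hB : SmoothFieldOn U B)
      (hBf : SmoothFunOn I U (fun y ↦ d% f y (B y))) :
      mlieBracket I A (mlieBracket I B (f • W)) x =
        d% (fun y ↦ d% f y (B y)) x (A x) • w + d% f x (B x) • mlieBracket I A W x
        + (d% f x (A x) • mlieBracket I B W x + f x • mlieBracket I A (mlieBracket I B W) x) := by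
    have h1 : mlieBracket I B (f • W) =ᶠ[𝓝 x]
        (fun y ↦ d% f y (B y)) • W + f • mlieBracket I B W := by
      filter_upwards [hU.mem_nhds hx, hV.mem_nhds hxV] with y hy hyV
      rw [mlieBracket_smul_right (hf.mdiffAt hy) (hW.mdiffAt hyV)]
      rfl
    have hBW := (hB.mono Set.inter_subset_left).mlieBracket (hW.mono (Set.inter_subset_right (s := U)))
    have hm : x ∈ U ∩ V := ⟨hx, hxV⟩
    have h2 : mlieBracket I A (mlieBracket I B (f • W)) x = _ :=
      Filter.EventuallyEq.mlieBracket_vectorField_eq (EventuallyEq.refl _ A) h1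
    rw [h2,
      mlieBracket_add_right ((hBf.mdiffAt hx).smul_section (hW.mdiffAt hxV))
        ((hf.mdiffAt hx).smul_section (hBW.mdiffAt hm)),
      mlieBracket_smul_right (hBf.mdiffAt hx) (hW.mdiffAt hxV),
      mlieBracket_smul_right (hf.mdiffAt hx) (hBW.mdiffAt hm), hWx]
  have : IsManifold I (minSmoothness ℝ 3) M := .of_le (n := ∞) minSmoothness_three_le_infty
  -- Compare the Jacobi identity for `f • W` with `f` times the one for `W`. The first-order terms
  -- `(X f) [Y, W] + (Y f) [X, W]` are symmetric in `X`, `Y` and cancel; only multiples of `w`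
  -- remain.
  have hJ (Z : Π x : M, TangentSpace I x) (hZ : ContMDiffAt I I.tangent ∞ (T% Z) x) :=
    leibniz_identity_mlieBracket_apply (I := I) (x := x) (U := X) (V := Y) (W := Z)
      ((hX x hx).of_le minSmoothness_two_le_infty) ((hY x hx).of_le minSmoothness_two_le_infty) (hZ.of_le minSmoothness_two_le_infty)
  have h1 := hJ (f • W) ((hf x hx).smul_section (hW x hxV))
  rw [key X Y hX hY hYf, key Y X hY hX hXf, hJ W (hW x hxV),
    mlieBracket_smul_right (hf.mdiffAt hx) (hW.mdiffAt hxV), hWx] at h1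
  have h2 : (d% f x (mlieBracket I X Y x) - (d% (fun y ↦ d% f y (Y y)) x (X x)
      - d% (fun y ↦ d% f y (X y)) x (Y x))) • w = 0 := by
    rw [← sub_eq_zero] at h1
    rw [← neg_eq_zero, ← h1]
    module
  exact sub_eq_zero.1 ((smul_eq_zero.1 h2).resolve_right hw)

end Frame

/-! ### Orthonormal frames and tensoriality of the curvature -/

section RiemannianFrame

variable {E : Type*} [NormedAddCommGroup E] [NormedSpace ℝ E]
  {H : Type*} [TopologicalSpace H] {I : ModelWithCorners ℝ E H}
  {M : Type*} [TopologicalSpace M] [ChartedSpace H M] [IsManifold I ∞ M]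
  [RiemannianBundle (fun x : M ↦ TangentSpace I x)]
  {ι : Type*} [Fintype ι] [DecidableEq ι]

/-- A smooth orthonormal frame of the tangent bundle over the open set `U`. -/
structure IsOrthonormalFrameOn (U : Set M) (e : ι → Π x : M, TangentSpace I x) : Prop where
  isOpen : IsOpen U
  smooth : ∀ i, SmoothFieldOn U (e i)
  inner_eq : ∀ x ∈ U, ∀ i j, (inner ℝ (e i x) (e j x) : ℝ) = if i = j then 1 else 0
  sum_inner_smul : ∀ x ∈ U, ∀ v : TangentSpace I x, ∑ i, (inner ℝ (e i x) v : ℝ) • e i x = v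

variable {U V : Set M} {e : ι → Π x : M, TangentSpace I x} {f : M → ℝ}
  {X X' Y Y' Z Z' : Π x : M, TangentSpace I x} {x : M}

theorem IsOrthonormalFrameOn.mono (he : IsOrthonormalFrameOn U e) (hV : IsOpen V) (h : V ⊆ U) :
    IsOrthonormalFrameOn V e where
  isOpen := hV
  smooth i := (he.smooth i).mono h
  inner_eq x hx := he.inner_eq x (h hx)
  sum_inner_smul x hx := he.sum_inner_smul x (h hx)

theorem IsOrthonormalFrameOn.inner_eq_sum (he : IsOrthonormalFrameOn U e) (hx : x ∈ U)
    (v w : TangentSpace I x) :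
    (inner ℝ v w : ℝ) = ∑ i, (inner ℝ (e i x) v : ℝ) * inner ℝ (e i x) w := by
  conv_lhs => rw [← he.sum_inner_smul x hx v]
  simp only [sum_inner, real_inner_smul_left]

variable [IsContMDiffRiemannianBundle I ∞ E (fun x : M ↦ TangentSpace I x)]

theorem SmoothFieldOn.inner (hX : SmoothFieldOn U X) (hY : SmoothFieldOn U Y) :
    SmoothFunOn I U (fun y ↦ (inner ℝ (X y) (Y y) : ℝ)) := fun x hx ↦
  ContMDiffAt.inner_bundle (F := E) (E := fun x : M ↦ TangentSpace I x) (b := id) (hX x hx) (hY x hx)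

/-- A map that is linear over the smooth functions depends only on the value of the field at `x`. -/
theorem IsOrthonormalFrameOn.eq_sum_of_tensorial (he : IsOrthonormalFrameOn U e)
    {W : Type*} [AddCommGroup W] [Module ℝ W] (Φ : (Π x : M, TangentSpace I x) → W)
    (hadd : ∀ Z Z', SmoothFieldOn U Z → SmoothFieldOn U Z' → Φ (Z + Z') = Φ Z + Φ Z')
    (hsmul : ∀ (f : M → ℝ) Z, SmoothFunOn I U f → SmoothFieldOn U Z → Φ (f • Z) = f x • Φ Z)
    (hcongr : ∀ Z Z', SmoothFieldOn U Z → SmoothFieldOn U Z' → (∀ y ∈ U, Z y = Z' y) → Φ Z = Φ Z')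
    (hZ : SmoothFieldOn U Z) : Φ Z = ∑ i, (inner ℝ (e i x) (Z x) : ℝ) • Φ (e i) := by
  have hz : SmoothFieldOn U (0 : Π x : M, TangentSpace I x) := by
    refine (SmoothFieldOn.smul (SmoothFunOn.const 0) hZ).congr he.isOpen ?_
    simp
  have hi (i : ι) : SmoothFieldOn U ((fun y ↦ (inner ℝ (e i y) (Z y) : ℝ)) • e i) :=
    .smul ((he.smooth i).inner hZ) (he.smooth i)
  have hs (s : Finset ι) : SmoothFieldOn U (∑ i ∈ s, (fun y ↦ (inner ℝ (e i y) (Z y) : ℝ)) • e i) ∧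
      Φ (∑ i ∈ s, (fun y ↦ (inner ℝ (e i y) (Z y) : ℝ)) • e i)
        = ∑ i ∈ s, (inner ℝ (e i x) (Z x) : ℝ) • Φ (e i) := by
    induction s using Finset.induction_on with
    | empty =>
      refine ⟨by simpa using hz, ?_⟩
      have := hadd 0 0 hz hz
      simpa using this
    | insert a s ha ih =>
      rw [Finset.sum_insert ha, Finset.sum_insert ha]
      refine ⟨(hi a).add ih.1, ?_⟩
      rw [hadd _ _ (hi a) ih.1, ih.2, hsmul _ _ ((he.smooth a).inner hZ) (he.smooth a)]
  rw [← (hs Finset.univ).2]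
  -- The expansion in the frame is valid only on `U`, so locality of `Φ` is needed to replace `Z` by
  -- it.
  refine hcongr _ _ hZ (hs _).1 fun y hy ↦ ?_
  rw [Finset.sum_apply]
  exact (he.sum_inner_smul y hy (Z y)).symm

variable [FiniteDimensional ℝ E]

/-- By the Leibniz rule `[X, f e_i] - f [X, e_i] = (X f) e_i`, and pairing with the unit field `e_i`
recovers `X f` from brackets and the metric, both already smooth. -/
theorem IsOrthonormalFrameOn.smooth_mvfderiv [Nonempty ι] (he : IsOrthonormalFrameOn U e)
    (hf : SmoothFunOn I U f) (hX : SmoothFieldOn U X) :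
    SmoothFunOn I U (fun y ↦ d% f y (X y)) := by
  have : CompleteSpace E := FiniteDimensional.complete ℝ E
  obtain ⟨i⟩ := ‹Nonempty ι›
  have h1 := (he.smooth i).inner
    ((hX.mlieBracket (.smul hf (he.smooth i))).sub (.smul hf (hX.mlieBracket (he.smooth i))))
  intro x hx
  refine (h1 x hx).congr_of_eventuallyEq ?_
  filter_upwards [he.isOpen.mem_nhds hx] with y hy
  simp only [Pi.sub_apply, Pi.smul_apply']
  rw [mlieBracket_smul_right (hf.mdiffAt hy) ((he.smooth i).mdiffAt hy), add_sub_cancel_right,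
    real_inner_smul_right, he.inner_eq y hy, if_pos rfl, mul_one]

theorem IsOrthonormalFrameOn.mvfderiv_mlieBracket [Nonempty ι] (he : IsOrthonormalFrameOn U e)
    (hx : x ∈ U) (hX : SmoothFieldOn U X) (hY : SmoothFieldOn U Y) (hf : SmoothFunOn I U f) :
    d% f x (mlieBracket I X Y x)
      = d% (fun y ↦ d% f y (Y y)) x (X x) - d% (fun y ↦ d% f y (X y)) x (Y x) := by
  have : CompleteSpace E := FiniteDimensional.complete ℝ E
  exact ContactGeometry.mvfderiv_mlieBracket he.isOpen hx hX hY hf (he.smooth_mvfderiv hf hY)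
    (he.smooth_mvfderiv hf hX)

/-- The vector field `∇_X Z`. -/
def covDeriv (X Z : Π x : M, TangentSpace I x) : Π x : M, TangentSpace I x :=
  fun y ↦ leviCivita I M Z y (X y)

theorem covDeriv_add (hZ : MDiffAt (T% Z) x) (hZ' : MDiffAt (T% Z') x) :
    covDeriv X (Z + Z') x = covDeriv X Z x + covDeriv X Z' x := by
  simp only [covDeriv]
  rw [(leviCivita I M).isCovariantDerivativeOnUniv.add hZ hZ']
  rfl

theorem covDeriv_smul (hf : MDiffAt f x) (hZ : MDiffAt (T% Z) x) :
    covDeriv X (f • Z) x = f x • covDeriv X Z x + d% f x (X x) • Z x := by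
  simp only [covDeriv]
  rw [(leviCivita I M).isCovariantDerivativeOnUniv.leibniz hZ hf]
  rfl

theorem covDeriv_congr (hZ : MDiffAt (T% Z) x) (hZ' : MDiffAt (T% Z') x)
    (h : ∀ᶠ y in 𝓝 x, Z y = Z' y) : covDeriv X Z x = covDeriv X Z' x := by
  simp only [covDeriv]
  rw [(leviCivita I M).isCovariantDerivativeOnUniv.congr_of_eventuallyEq hZ hZ' univ_mem h]

/-- The connection is defined pointwise by Koszul's formula. Its components along the frame are
Koszul expressions in smooth fields, hence smooth, and this makes second covariant derivatives
meaningful. -/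
theorem IsOrthonormalFrameOn.smooth_covDeriv [Nonempty ι] (he : IsOrthonormalFrameOn U e)
    (hX : SmoothFieldOn U X) (hZ : SmoothFieldOn U Z) : SmoothFieldOn U (covDeriv X Z) := by
  have : CompleteSpace E := FiniteDimensional.complete ℝ E
  have hk (i : ι) : SmoothFunOn I U (koszul I X Z (e i)) := by
    have hi := he.smooth i
    have h := ((((((he.smooth_mvfderiv (hZ.inner hi) hX).add
      (he.smooth_mvfderiv (hi.inner hX) hZ)).sub (he.smooth_mvfderiv (hX.inner hZ) hi)).add
      ((hX.mlieBracket hZ).inner hi)).sub ((hZ.mlieBracket hi).inner hX)).add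
      ((hi.mlieBracket hX).inner hZ)).mul (SmoothFunOn.const (2⁻¹))
    exact h
  have hs : SmoothFieldOn U (fun y ↦ ∑ i, (koszul I X Z (e i) • e i) y) := fun x hx ↦
    ContMDiffAt.sum_section fun i _ ↦ (SmoothFieldOn.smul (hk i) (he.smooth i)) x hx
  refine hs.congr he.isOpen fun y hy ↦ ?_
  rw [← he.sum_inner_smul y hy (covDeriv X Z y)]
  refine Finset.sum_congr rfl fun i _ ↦ ?_
  rw [real_inner_comm, covDeriv,
    inner_leviCivita (hX.mdiffAt hy) (hZ.mdiffAt hy) ((he.smooth i).mdiffAt hy)]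
  rfl

theorem curvatureOnFields_eq : curvatureOnFields I X Y Z x =
    covDeriv X (covDeriv Y Z) x - covDeriv Y (covDeriv X Z) x
      - leviCivita I M Z x (mlieBracket I X Y x) := rfl

theorem curvatureOnFields_swap :
    curvatureOnFields I X Y Z x = - curvatureOnFields I Y X Z x := by
  rw [curvatureOnFields_eq, curvatureOnFields_eq, mlieBracket_swap_apply, map_neg]
  abel

section Tensorial

variable [Nonempty ι] (he : IsOrthonormalFrameOn U e) (hx : x ∈ U)
include he hx

theorem curvatureOnFields_add_left (hX : SmoothFieldOn U X) (hX' : SmoothFieldOn U X')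
    (hZ : SmoothFieldOn U Z) :
    curvatureOnFields I (X + X') Y Z x
      = curvatureOnFields I X Y Z x + curvatureOnFields I X' Y Z x := by
  have : CompleteSpace E := FiniteDimensional.complete ℝ E
  have h1 : covDeriv (X + X') Z = covDeriv X Z + covDeriv X' Z := by
    ext1 y; simp [covDeriv]
  rw [curvatureOnFields_eq, curvatureOnFields_eq, curvatureOnFields_eq, h1,
    covDeriv_add ((he.smooth_covDeriv hX hZ).mdiffAt hx) ((he.smooth_covDeriv hX' hZ).mdiffAt hx),
    mlieBracket_add_left (hX.mdiffAt hx) (hX'.mdiffAt hx), map_add]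
  simp only [covDeriv, Pi.add_apply, map_add]
  abel

theorem curvatureOnFields_smul_left (hf : SmoothFunOn I U f) (hX : SmoothFieldOn U X)
    (hZ : SmoothFieldOn U Z) :
    curvatureOnFields I (f • X) Y Z x = f x • curvatureOnFields I X Y Z x := by
  have : CompleteSpace E := FiniteDimensional.complete ℝ E
  have h1 : covDeriv (f • X) Z = f • covDeriv X Z := by
    ext1 y; simp [covDeriv]
  rw [curvatureOnFields_eq, curvatureOnFields_eq, h1,
    covDeriv_smul (hf.mdiffAt hx) ((he.smooth_covDeriv hX hZ).mdiffAt hx),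
    mlieBracket_smul_left (hf.mdiffAt hx) (hX.mdiffAt hx), map_add, map_smul, map_smul]
  simp only [covDeriv, Pi.smul_apply', map_smul]
  module

theorem curvatureOnFields_add_right (hX : SmoothFieldOn U X) (hY : SmoothFieldOn U Y)
    (hZ : SmoothFieldOn U Z) (hZ' : SmoothFieldOn U Z') :
    curvatureOnFields I X Y (Z + Z') x
      = curvatureOnFields I X Y Z x + curvatureOnFields I X Y Z' x := by
  have h1 (A B : Π x : M, TangentSpace I x) (hA : SmoothFieldOn U A) (hB : SmoothFieldOn U B) :
      covDeriv A (covDeriv B (Z + Z')) x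
        = covDeriv A (covDeriv B Z) x + covDeriv A (covDeriv B Z') x := by
    rw [← covDeriv_add ((he.smooth_covDeriv hB hZ).mdiffAt hx)
      ((he.smooth_covDeriv hB hZ').mdiffAt hx)]
    refine covDeriv_congr ((he.smooth_covDeriv hB (hZ.add hZ')).mdiffAt hx)
      (((he.smooth_covDeriv hB hZ).add (he.smooth_covDeriv hB hZ')).mdiffAt hx) ?_
    filter_upwards [he.isOpen.mem_nhds hx] with y hy
    exact covDeriv_add (hZ.mdiffAt hy) (hZ'.mdiffAt hy)
  rw [curvatureOnFields_eq, curvatureOnFields_eq, curvatureOnFields_eq, h1 X Y hX hY, h1 Y X hY hX,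
    (leviCivita I M).isCovariantDerivativeOnUniv.add (hZ.mdiffAt hx) (hZ'.mdiffAt hx), add_apply]
  abel

/-- The terms with one derivative of `f` on a covariant derivative of `Z` are symmetric in `X`, `Y`.
The second derivatives of `f` leave the commutator, which cancels `([X, Y] f) Z` from `∇_[X,Y] (f
Z)`. -/
theorem curvatureOnFields_smul_right (hf : SmoothFunOn I U f) (hX : SmoothFieldOn U X)
    (hY : SmoothFieldOn U Y) (hZ : SmoothFieldOn U Z) :
    curvatureOnFields I X Y (f • Z) x = f x • curvatureOnFields I X Y Z x := by
  have h1 (A B : Π x : M, TangentSpace I x) (hA : SmoothFieldOn U A) (hB : SmoothFieldOn U B) :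
      covDeriv A (covDeriv B (f • Z)) x
        = f x • covDeriv A (covDeriv B Z) x + d% f x (A x) • covDeriv B Z x
          + (d% f x (B x) • covDeriv A Z x + d% (fun y ↦ d% f y (B y)) x (A x) • Z x) := by
    have hBZ := he.smooth_covDeriv hB hZ
    have hBf := he.smooth_mvfderiv hf hB
    rw [← covDeriv_smul (hf.mdiffAt hx) (hBZ.mdiffAt hx),
      ← covDeriv_smul (hBf.mdiffAt hx) (hZ.mdiffAt hx),
      ← covDeriv_add ((SmoothFieldOn.smul hf hBZ).mdiffAt hx)
        ((SmoothFieldOn.smul hBf hZ).mdiffAt hx)]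
    refine covDeriv_congr ((he.smooth_covDeriv hB (.smul hf hZ)).mdiffAt hx)
      (((SmoothFieldOn.smul hf hBZ).add (SmoothFieldOn.smul hBf hZ)).mdiffAt hx) ?_
    filter_upwards [he.isOpen.mem_nhds hx] with y hy
    exact covDeriv_smul (hf.mdiffAt hy) (hZ.mdiffAt hy)
  rw [curvatureOnFields_eq, curvatureOnFields_eq, h1 X Y hX hY, h1 Y X hY hX,
    (leviCivita I M).isCovariantDerivativeOnUniv.leibniz (hZ.mdiffAt hx) (hf.mdiffAt hx), add_apply,
    ContinuousLinearMap.smulRight_apply, he.mvfderiv_mlieBracket hx hX hY hf, smul_apply]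
  module

theorem curvatureOnFields_congr_left (hX : SmoothFieldOn U X) (hX' : SmoothFieldOn U X')
    (hZ : SmoothFieldOn U Z) (h : ∀ y ∈ U, X y = X' y) :
    curvatureOnFields I X Y Z x = curvatureOnFields I X' Y Z x := by
  have h1 : X =ᶠ[𝓝 x] X' := by filter_upwards [he.isOpen.mem_nhds hx] with y hy using h y hy
  have h2 := Filter.EventuallyEq.mlieBracket_vectorField_eq h1 (EventuallyEq.refl _ Y)
  rw [curvatureOnFields_eq, curvatureOnFields_eq]
  rw [covDeriv_congr ((he.smooth_covDeriv hX hZ).mdiffAt hx)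
    ((he.smooth_covDeriv hX' hZ).mdiffAt hx) (by
      filter_upwards [he.isOpen.mem_nhds hx] with y hy
      rw [covDeriv, covDeriv, h y hy])]
  rw [show mlieBracket I X Y x = _ from h2]
  simp only [covDeriv, h x hx]

theorem curvatureOnFields_congr_right (hX : SmoothFieldOn U X) (hY : SmoothFieldOn U Y)
    (hZ : SmoothFieldOn U Z) (hZ' : SmoothFieldOn U Z') (h : ∀ y ∈ U, Z y = Z' y) :
    curvatureOnFields I X Y Z x = curvatureOnFields I X Y Z' x := by
  have h0 (A : Π x : M, TangentSpace I x) (y : M) (hy : y ∈ U) :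
      covDeriv A Z y = covDeriv A Z' y := by
    refine covDeriv_congr (hZ.mdiffAt hy) (hZ'.mdiffAt hy) ?_
    filter_upwards [he.isOpen.mem_nhds hy] with y hy using h y hy
  have h1 (A B : Π x : M, TangentSpace I x) (hB : SmoothFieldOn U B) :
      covDeriv A (covDeriv B Z) x = covDeriv A (covDeriv B Z') x := by
    refine covDeriv_congr ((he.smooth_covDeriv hB hZ).mdiffAt hx)
      ((he.smooth_covDeriv hB hZ').mdiffAt hx) ?_
    filter_upwards [he.isOpen.mem_nhds hx] with y hy using h0 B y hy
  rw [curvatureOnFields_eq, curvatureOnFields_eq, h1 X Y hY, h1 Y X hX]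
  congr 1
  exact h0 (fun y ↦ mlieBracket I X Y y) x hx

theorem curvatureOnFields_eq_sum_left (hX : SmoothFieldOn U X)
    (hZ : SmoothFieldOn U Z) : curvatureOnFields I X Y Z x
      = ∑ i, (inner ℝ (e i x) (X x) : ℝ) • curvatureOnFields I (e i) Y Z x :=
  he.eq_sum_of_tensorial (fun X ↦ curvatureOnFields I X Y Z x)
    (fun _ _ h h' ↦ curvatureOnFields_add_left he hx h h' hZ)
    (fun _ _ hf h ↦ curvatureOnFields_smul_left he hx hf h hZ)
    (fun _ _ h h' ↦ curvatureOnFields_congr_left he hx h h' hZ) hX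

theorem curvatureOnFields_eq_sum_right (hX : SmoothFieldOn U X) (hY : SmoothFieldOn U Y)
    (hZ : SmoothFieldOn U Z) : curvatureOnFields I X Y Z x
      = ∑ i, (inner ℝ (e i x) (Z x) : ℝ) • curvatureOnFields I X Y (e i) x :=
  he.eq_sum_of_tensorial (fun Z ↦ curvatureOnFields I X Y Z x)
    (fun _ _ h h' ↦ curvatureOnFields_add_right he hx hX hY h h')
    (fun _ _ hf h ↦ curvatureOnFields_smul_right he hx hf hX hY h)
    (fun _ _ h h' ↦ curvatureOnFields_congr_right he hx hX hY h h') hZ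

end Tensorial

end RiemannianFrame

/-! ### Curvature and Ricci tensor through connection coefficients -/

section FrameCurvature

variable {E : Type*} [NormedAddCommGroup E] [NormedSpace ℝ E]
  {H : Type*} [TopologicalSpace H] {I : ModelWithCorners ℝ E H}
  {M : Type*} [TopologicalSpace M] [ChartedSpace H M] [IsManifold I ∞ M]
  [RiemannianBundle (fun x : M ↦ TangentSpace I x)]
  [IsContMDiffRiemannianBundle I ∞ E (fun x : M ↦ TangentSpace I x)] [FiniteDimensional ℝ E]
  {ι : Type*} [Fintype ι] [DecidableEq ι] [Nonempty ι]
  {U : Set M} {e : ι → Π x : M, TangentSpace I x} {f : M → ℝ}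
  {X Y Z W : Π x : M, TangentSpace I x} {x : M}

/-- The curvature of tangent vectors is determined by the curvature of a local frame. -/
theorem IsOrthonormalFrameOn.curvature_eq_sum (he : IsOrthonormalFrameOn U e) (hx : x ∈ U)
    (u v w : TangentSpace I x) : curvature I x u v w =
      ∑ i, (inner ℝ (e i x) u : ℝ) • ∑ j, (inner ℝ (e j x) v : ℝ) • ∑ k,
        (inner ℝ (e k x) w : ℝ) • curvatureOnFields I (e i) (e j) (e k) x := by
  obtain ⟨U₁, hU₁, hx₁, h₁⟩ := exists_smoothFieldOn_extend u
  obtain ⟨U₂, hU₂, hx₂, h₂⟩ := exists_smoothFieldOn_extend v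
  obtain ⟨U₃, hU₃, hx₃, h₃⟩ := exists_smoothFieldOn_extend w
  have hV : IsOpen (U ∩ (U₁ ∩ (U₂ ∩ U₃))) := he.isOpen.inter (hU₁.inter (hU₂.inter hU₃))
  have hxV : x ∈ U ∩ (U₁ ∩ (U₂ ∩ U₃)) := ⟨hx, hx₁, hx₂, hx₃⟩
  have he' := he.mono hV Set.inter_subset_left
  replace h₁ := h₁.mono (V := U ∩ (U₁ ∩ (U₂ ∩ U₃))) fun y hy ↦ hy.2.1
  replace h₂ := h₂.mono (V := U ∩ (U₁ ∩ (U₂ ∩ U₃))) fun y hy ↦ hy.2.2.1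
  replace h₃ := h₃.mono (V := U ∩ (U₁ ∩ (U₂ ∩ U₃))) fun y hy ↦ hy.2.2.2
  rw [curvature, curvatureOnFields_eq_sum_left he' hxV h₁ h₃]
  refine Finset.sum_congr rfl fun i _ ↦ ?_
  -- Antisymmetry moves the second slot into the first, where tensoriality is available, and back.
  rw [curvatureOnFields_swap, curvatureOnFields_eq_sum_left he' hxV h₂ h₃, extend_apply_self,
    ← Finset.sum_neg_distrib]
  congr 1
  refine Finset.sum_congr rfl fun j _ ↦ ?_
  rw [← smul_neg, ← curvatureOnFields_swap,
    curvatureOnFields_eq_sum_right he' hxV (he'.smooth i) (he'.smooth j) h₃, extend_apply_self,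
    extend_apply_self]

/-- The Ricci tensor in a local orthonormal frame. -/
theorem IsOrthonormalFrameOn.ricci_eq_sum (he : IsOrthonormalFrameOn U e) (hx : x ∈ U)
    (v w : TangentSpace I x) : ricci I x v w =
      ∑ j, (inner ℝ (e j x) v : ℝ) * ∑ k, (inner ℝ (e k x) w : ℝ) *
        ∑ i, (inner ℝ (curvatureOnFields I (e i) (e j) (e k) x) (e i x) : ℝ) := by
  have h1 (b : TangentSpace I x) : (inner ℝ (curvature I x b v w) b : ℝ) =
      ∑ i, (inner ℝ (e i x) b : ℝ) * inner ℝ (∑ j, (inner ℝ (e j x) v : ℝ) • ∑ k,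
        (inner ℝ (e k x) w : ℝ) • curvatureOnFields I (e i) (e j) (e k) x) b := by
    rw [he.curvature_eq_sum hx, sum_inner]
    simp only [real_inner_smul_left]
  -- Parseval's identity turns the trace over the standard basis into a trace over the frame `e`.
  have h2 (i : ι) (z : TangentSpace I x) :
      ∑ b, (inner ℝ (e i x) (stdOrthonormalBasis ℝ (TangentSpace I x) b) : ℝ) *
        inner ℝ z (stdOrthonormalBasis ℝ (TangentSpace I x) b) = inner ℝ z (e i x) := by
    rw [← (stdOrthonormalBasis ℝ (TangentSpace I x)).sum_inner_mul_inner z (e i x)]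
    refine Finset.sum_congr rfl fun b _ ↦ ?_
    rw [real_inner_comm (e i x), mul_comm]
  simp only [ricci, h1]
  rw [Finset.sum_comm]
  refine (Finset.sum_congr rfl fun i _ ↦ h2 i _).trans ?_
  simp only [sum_inner, real_inner_smul_left, Finset.mul_sum]
  rw [Finset.sum_comm]
  refine Finset.sum_congr rfl fun j _ ↦ ?_
  rw [Finset.sum_comm]

theorem IsOrthonormalFrameOn.ricci_frame (he : IsOrthonormalFrameOn U e) (hx : x ∈ U) (j k : ι) :
    ricci I x (e j x) (e k x) =
      ∑ i, (inner ℝ (curvatureOnFields I (e i) (e j) (e k) x) (e i x) : ℝ) := by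
  simp [he.ricci_eq_sum hx, he.inner_eq x hx]

theorem IsOrthonormalFrameOn.inner_ricciOperator (he : IsOrthonormalFrameOn U e) (hx : x ∈ U)
    (v w : TangentSpace I x) : (inner ℝ (ricciOperator I x v) w : ℝ) = ricci I x v w := by
  -- The frame formula exhibits `Ric(v, ·)` as pairing with a fixed vector; expanding that vector in
  -- the standard basis then gives the claim.
  have h1 (w : TangentSpace I x) : ricci I x v w = inner ℝ (∑ k, (∑ j, (inner ℝ (e j x) v : ℝ) *
      ∑ i, (inner ℝ (curvatureOnFields I (e i) (e j) (e k) x) (e i x) : ℝ)) • e k x) w := by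
    simp only [he.ricci_eq_sum hx, sum_inner, real_inner_smul_left, Finset.sum_mul, Finset.mul_sum]
    rw [Finset.sum_comm]
    refine Finset.sum_congr rfl fun k _ ↦ Finset.sum_congr rfl fun j _ ↦
      Finset.sum_congr rfl fun i _ ↦ by ring
  rw [ricciOperator, sum_inner, h1 w]
  simp only [real_inner_smul_left, h1]
  exact (stdOrthonormalBasis ℝ (TangentSpace I x)).sum_inner_mul_inner _ w

/-- The coefficients `g(∇_{e_i} e_j, e_k)` of the Levi-Civita connection in a frame. -/
def connectionCoeff (e : ι → Π x : M, TangentSpace I x) (i j k : ι) (y : M) : ℝ :=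
  inner ℝ (covDeriv (e i) (e j) y) (e k y)

theorem IsOrthonormalFrameOn.smooth_connectionCoeff (he : IsOrthonormalFrameOn U e) (i j k : ι) :
    SmoothFunOn I U (connectionCoeff e i j k) :=
  (he.smooth_covDeriv (he.smooth i) (he.smooth j)).inner (he.smooth k)

theorem mvfderiv_inner_covDeriv (hX : MDiffAt (T% X) x) (hY : MDiffAt (T% Y) x)
    (hZ : MDiffAt (T% Z) x) : d% (fun y ↦ (inner ℝ (Y y) (Z y) : ℝ)) x (X x)
      = inner ℝ (covDeriv X Y x) (Z x) + inner ℝ (Y x) (covDeriv X Z x) :=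
  leviCivita_metric hX hY hZ

theorem mlieBracket_eq_covDeriv_sub (hX : MDiffAt (T% X) x) (hY : MDiffAt (T% Y) x) :
    mlieBracket I X Y x = covDeriv X Y x - covDeriv Y X x :=
  ((CovariantDerivative.torsion_eq_zero_iff _).1 leviCivita_torsion hX hY).symm

omit [Nonempty ι] in
-- Differentiate the constant `g(e_j, e_k)` by metric compatibility.
theorem IsOrthonormalFrameOn.connectionCoeff_swap (he : IsOrthonormalFrameOn U e) (hx : x ∈ U)
    (i j k : ι) : connectionCoeff e i k j x = - connectionCoeff e i j k x := by
  have h := mvfderiv_inner_covDeriv ((he.smooth i).mdiffAt hx) ((he.smooth j).mdiffAt hx)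
    ((he.smooth k).mdiffAt hx)
  rw [mvfderiv_eq_zero_of_eventuallyEq_const (c := if j = k then 1 else 0) (by
    filter_upwards [he.isOpen.mem_nhds hx] with y hy using he.inner_eq y hy j k), zero_apply,
    real_inner_comm (covDeriv (e i) (e k) x)] at h
  simp only [connectionCoeff]
  linarith

omit [Nonempty ι] in
theorem IsOrthonormalFrameOn.mlieBracket_eq_sum (he : IsOrthonormalFrameOn U e) (hx : x ∈ U)
    (i j : ι) : mlieBracket I (e i) (e j) x =
      ∑ m, (connectionCoeff e i j m x - connectionCoeff e j i m x) • e m x := by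
  rw [← he.sum_inner_smul x hx (mlieBracket I (e i) (e j) x),
    mlieBracket_eq_covDeriv_sub ((he.smooth i).mdiffAt hx) ((he.smooth j).mdiffAt hx)]
  refine Finset.sum_congr rfl fun m _ ↦ ?_
  rw [inner_sub_right, real_inner_comm, real_inner_comm (covDeriv (e j) (e i) x)]
  rfl

/-- The commutator of the frame derivations. -/
theorem IsOrthonormalFrameOn.mvfderiv_comm (he : IsOrthonormalFrameOn U e) (hx : x ∈ U)
    (hf : SmoothFunOn I U f) (i j : ι) :
    d% (fun y ↦ d% f y (e j y)) x (e i x) - d% (fun y ↦ d% f y (e i y)) x (e j x)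
      = ∑ m, (connectionCoeff e i j m x - connectionCoeff e j i m x) * d% f x (e m x) := by
  rw [← he.mvfderiv_mlieBracket hx (he.smooth i) (he.smooth j) hf, he.mlieBracket_eq_sum hx]
  simp

/-- The curvature of an orthonormal frame in terms of the connection coefficients. -/
theorem IsOrthonormalFrameOn.inner_curvatureOnFields (he : IsOrthonormalFrameOn U e) (hx : x ∈ U)
    (i j k l : ι) : (inner ℝ (curvatureOnFields I (e i) (e j) (e k) x) (e l x) : ℝ) =
      d% (connectionCoeff e j k l) x (e i x) - d% (connectionCoeff e i k l) x (e j x)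
      - ∑ m, connectionCoeff e j k m x * connectionCoeff e i l m x
      + ∑ m, connectionCoeff e i k m x * connectionCoeff e j l m x
      - ∑ m, (connectionCoeff e i j m x - connectionCoeff e j i m x) * connectionCoeff e m k l x := by
  have h1 (i j : ι) : (inner ℝ (covDeriv (e i) (covDeriv (e j) (e k)) x) (e l x) : ℝ) =
      d% (connectionCoeff e j k l) x (e i x)
        - ∑ m, connectionCoeff e j k m x * connectionCoeff e i l m x := by
    have h := mvfderiv_inner_covDeriv ((he.smooth i).mdiffAt hx)
      ((he.smooth_covDeriv (he.smooth j) (he.smooth k)).mdiffAt hx) ((he.smooth l).mdiffAt hx)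
    rw [he.inner_eq_sum hx (covDeriv (e j) (e k) x)] at h
    refine (eq_sub_of_add_eq h.symm).trans ?_
    congr 1
    refine Finset.sum_congr rfl fun m _ ↦ ?_
    rw [real_inner_comm, real_inner_comm (covDeriv (e i) (e l) x)]
    rfl
  rw [curvatureOnFields_eq, inner_sub_left, inner_sub_left, h1, h1, he.mlieBracket_eq_sum hx,
    map_sum, sum_inner]
  simp only [map_smul, real_inner_smul_left]
  change _ - ∑ m, _ * connectionCoeff e m k l x = _
  ring

end FrameCurvature

/-! ### Contact frames and the shape of `∇ξ` -/

section ContactFrame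

variable {M : Type*} [TopologicalSpace M] [ChartedSpace (EuclideanSpace ℝ (Fin 3)) M]

theorem finrank_tangentSpace_three (x : M) : Module.finrank ℝ (TangentSpace (𝓡 3) x) = 3 :=
  finrank_euclideanSpace_fin (𝕜 := ℝ) (n := 3)

theorem extDerivOnFields_swap (η : Π x : M, TangentSpace (𝓡 3) x →L[ℝ] ℝ)
    (X Y : Π x : M, TangentSpace (𝓡 3) x) (x : M) :
    extDerivOnFields (𝓡 3) η X Y x = - extDerivOnFields (𝓡 3) η Y X x := by
  rw [extDerivOnFields, extDerivOnFields, mlieBracket_swap_apply, map_neg]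
  ring

variable [RiemannianBundle (fun x : M ↦ TangentSpace (𝓡 3) x)]

theorem sum_inner_smul_of_orthonormal {x : M} {b : Fin 3 → TangentSpace (𝓡 3) x}
    (hb : ∀ i j, (inner ℝ (b i) (b j) : ℝ) = if i = j then 1 else 0) (v : TangentSpace (𝓡 3) x) :
    ∑ i, (inner ℝ (b i) v : ℝ) • b i = v := by
  have ho : Orthonormal ℝ b := orthonormal_iff_ite.2 hb
  have hc : Fintype.card (Fin 3) = Module.finrank ℝ (TangentSpace (𝓡 3) x) := by
    rw [finrank_tangentSpace_three, Fintype.card_fin]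
  have hcoe := coe_basisOfOrthonormalOfCardEqFinrank ho hc
  have h := ((basisOfOrthonormalOfCardEqFinrank ho hc).toOrthonormalBasis
    (by rwa [hcoe])).sum_repr' v
  simpa [hcoe] using h

theorem exists_inner_eq_zero_ne_zero (x : M) (z : TangentSpace (𝓡 3) x) (hz : ‖z‖ = 1) :
    ∃ w : TangentSpace (𝓡 3) x, (inner ℝ z w : ℝ) = 0 ∧ w ≠ 0 := by
  by_contra! h
  have : Module.finrank ℝ (TangentSpace (𝓡 3) x) ≤ 1 := by
    refine finrank_le_one z fun w ↦ ⟨inner ℝ z w, ?_⟩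
    have h1 := h (w - (inner ℝ z w : ℝ) • z) (by
      rw [inner_sub_right, real_inner_smul_right, real_inner_self_eq_norm_sq, hz]
      ring)
    exact (sub_eq_zero.1 h1).symm
  rw [finrank_tangentSpace_three] at this
  omega

variable [IsManifold (𝓡 3) ∞ M]

variable {S : ContactMetricStructure M} {U : Set M} {e : Fin 3 → Π x : M, TangentSpace (𝓡 3) x}
  {x : M}

/-- Skew-symmetry of `φ` is inherited from that of `dη`. -/
theorem ContactMetricStructure.inner_φ_left (S : ContactMetricStructure M) (x : M)
    (v w : TangentSpace (𝓡 3) x) : (inner ℝ (S.φ x v) w : ℝ) = - inner ℝ v (S.φ x w) := by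
  have hv := mdifferentiableAt_extend (𝓡 3) (EuclideanSpace ℝ (Fin 3)) v
  have hw := mdifferentiableAt_extend (𝓡 3) (EuclideanSpace ℝ (Fin 3)) w
  have h1 := S.extDeriv_η x _ _ hv hw
  have h2 := S.extDeriv_η x _ _ hw hv
  rw [extDerivOnFields_swap, h1, extend_apply_self, extend_apply_self] at h2
  rw [real_inner_comm]
  linarith

/-- Pair `φ² v = -v + η(v) ξ` with `ξ`: the left side vanishes because `φ` is skew and `φ ξ = 0`. -/
theorem ContactMetricStructure.inner_ξ (S : ContactMetricStructure M) (x : M)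
    (v : TangentSpace (𝓡 3) x) : (inner ℝ v (S.ξ x) : ℝ) = S.η x v := by
  have h : (inner ℝ (S.φ x (S.φ x v)) (S.ξ x) : ℝ) = 0 := by
    rw [S.inner_φ_left, S.φ_ξ, inner_zero_right, neg_zero]
  rw [S.φ_φ, inner_add_left, inner_neg_left, real_inner_smul_left, real_inner_self_eq_norm_sq,
    S.norm_ξ] at h
  linarith

/-- An orthonormal frame of the form `(e, φ e, ξ)`. -/
structure IsContactFrameOn (S : ContactMetricStructure M) (U : Set M)
    (e : Fin 3 → Π x : M, TangentSpace (𝓡 3) x) : Prop extends IsOrthonormalFrameOn U e where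
  frame_two : e 2 = S.ξ
  φ_frame_zero : ∀ y ∈ U, S.φ y (e 0 y) = e 1 y

theorem IsContactFrameOn.φ_frame_one (he : IsContactFrameOn S U e) (hx : x ∈ U) :
    S.φ x (e 1 x) = - e 0 x := by
  have h := he.inner_eq x hx 0 2
  rw [he.frame_two, S.inner_ξ] at h
  rw [← he.φ_frame_zero x hx, S.φ_φ, h]
  simp

theorem SmoothFieldOn.φ {X : Π x : M, TangentSpace (𝓡 3) x} (hX : SmoothFieldOn U X)
    (S : ContactMetricStructure M) : SmoothFieldOn U (fun y ↦ S.φ y (X y)) := fun y hy ↦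
  (S.contMDiff_φ y).clm_bundle_apply (hX y hy)

variable [IsContMDiffRiemannianBundle (𝓡 3) ∞ (EuclideanSpace ℝ (Fin 3))
      (fun x : M ↦ TangentSpace (𝓡 3) x)]

/-- Extend a nonzero vector orthogonal to `ξ`, project off `ξ`, and normalize where the result is
nonzero. On the orthogonal complement of `ξ`, `φ` is a skew isometry, so `φ` of the first field
supplies the second. -/
theorem exists_contactFrame (S : ContactMetricStructure M) (x : M) :
    ∃ (U : Set M) (e : Fin 3 → Π x : M, TangentSpace (𝓡 3) x), x ∈ U ∧ IsContactFrameOn S U e := by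
  obtain ⟨w, hw, hw0⟩ := exists_inner_eq_zero_ne_zero x (S.ξ x) (S.norm_ξ x)
  obtain ⟨V, hV, hxV, hW⟩ := exists_smoothFieldOn_extend w
  set W := extend (EuclideanSpace ℝ (Fin 3)) w
  have hWx : W x = w := extend_apply_self _ w
  have hξ (U : Set M) : SmoothFieldOn U S.ξ := fun y _ ↦ S.contMDiff_ξ y
  set X : Π x : M, TangentSpace (𝓡 3) x := W - (fun y ↦ (inner ℝ (S.ξ y) (W y) : ℝ)) • S.ξ with hX
  have hXs : SmoothFieldOn V X := hW.sub (.smul ((hξ V).inner hW) (hξ V))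
  have hξX (y : M) : (inner ℝ (X y) (S.ξ y) : ℝ) = 0 := by
    rw [real_inner_comm, hX, Pi.sub_apply, Pi.smul_apply', inner_sub_right, real_inner_smul_right,
      real_inner_self_eq_norm_sq, S.norm_ξ]
    ring
  have hN := hXs.inner hXs
  have hXx : X x = w := by
    rw [hX, Pi.sub_apply, Pi.smul_apply', hWx, hw, zero_smul, sub_zero]
  set N : M → ℝ := fun y ↦ inner ℝ (X y) (X y)
  have hUo : IsOpen (V ∩ {y | 0 < N y}) := by
    rw [isOpen_iff_mem_nhds]
    rintro y ⟨hy, hNy⟩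
    exact inter_mem (hV.mem_nhds hy)
      ((hN y hy).continuousAt.eventually (lt_mem_nhds hNy))
  have hc : SmoothFunOn (𝓡 3) (V ∩ {y | 0 < N y}) (fun y ↦ (√(N y))⁻¹) := by
    rintro y ⟨hy, hNy⟩
    have h1 : ContDiffAt ℝ ∞ (fun t : ℝ ↦ (√t)⁻¹) (N y) :=
      (contDiffAt_id.sqrt hNy.ne').inv (Real.sqrt_pos.2 hNy).ne'
    exact h1.contMDiffAt.comp y (hN y hy)
  set A : Π x : M, TangentSpace (𝓡 3) x := (fun y ↦ (√(N y))⁻¹) • X with hA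
  have hAs : SmoothFieldOn (V ∩ {y | 0 < N y}) A := .smul hc (hXs.mono Set.inter_subset_left)
  have hAξ (y : M) : (inner ℝ (A y) (S.ξ y) : ℝ) = 0 := by
    rw [hA, Pi.smul_apply', real_inner_smul_left, hξX, mul_zero]
  have hAA (y : M) (hy : 0 < N y) : (inner ℝ (A y) (A y) : ℝ) = 1 := by
    rw [hA, Pi.smul_apply', real_inner_smul_left, real_inner_smul_right]
    change _ * (_ * N y) = _
    have := Real.mul_self_sqrt hy.le
    have h0 := (Real.sqrt_pos.2 hy).ne'
    field_simp
    nlinarith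
  have hφξ (y : M) (v) : (inner ℝ (S.φ y v) (S.ξ y) : ℝ) = 0 := by
    rw [S.inner_φ_left, S.φ_ξ, inner_zero_right, neg_zero]
  have hAφ (y : M) : (inner ℝ (A y) (S.φ y (A y)) : ℝ) = 0 := by
    have := S.inner_φ_left y (A y) (A y)
    rw [real_inner_comm] at this
    linarith
  have hφφ (y : M) (hy : 0 < N y) : (inner ℝ (S.φ y (A y)) (S.φ y (A y)) : ℝ) = 1 := by
    rw [S.inner_φ_left, S.φ_φ, ← S.inner_ξ, hAξ, zero_smul, add_zero, inner_neg_right, hAA y hy,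
      neg_neg]
  have hξξ (y : M) : (inner ℝ (S.ξ y) (S.ξ y) : ℝ) = 1 := by
    rw [S.inner_ξ, S.η_ξ]
  have hon (y : M) (hy : y ∈ V ∩ {y | 0 < N y}) (i j : Fin 3) :
      (inner ℝ ((![A, fun y ↦ S.φ y (A y), S.ξ] : Fin 3 → Π x : M, TangentSpace (𝓡 3) x) i y)
        ((![A, fun y ↦ S.φ y (A y), S.ξ] : Fin 3 → Π x : M, TangentSpace (𝓡 3) x) j y) : ℝ)
        = if i = j then 1 else 0 := by
    fin_cases i <;> fin_cases j <;>
      simp [-inner_self_eq_norm_sq_to_K, hAA y hy.2, hAφ y, hAξ y, hφφ y hy.2, hφξ y, hξξ y, real_inner_comm (A y) (S.φ y (A y)),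
        real_inner_comm (A y) (S.ξ y), real_inner_comm (S.φ y (A y)) (S.ξ y)]
  refine ⟨V ∩ {y | 0 < N y}, ![A, fun y ↦ S.φ y (A y), S.ξ], ⟨hxV, ?_⟩, ⟨⟨hUo, ?_, hon, ?_⟩, ?_, ?_⟩⟩
  · change 0 < (inner ℝ (X x) (X x) : ℝ)
    rw [hXx]
    exact real_inner_self_pos.2 hw0
  · intro i
    fin_cases i
    exacts [hAs, hAs.φ S, hξ _]
  · exact fun y hy v ↦ sum_inner_smul_of_orthonormal (hon y hy) v
  · rfl
  · exact fun y _ ↦ rfl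

namespace IsContactFrameOn

/-- Each `η(e_k)` is constant, so `dη(e_i, e_j) = -η([e_i, e_j])`, and the bracket is a difference
of covariant derivatives. -/
theorem connectionCoeff_sub (he : IsContactFrameOn S U e) (hx : x ∈ U) (i j : Fin 3) :
    connectionCoeff e i j 2 x - connectionCoeff e j i 2 x
      = - (2 * inner ℝ (e i x) (S.φ x (e j x))) := by
  have hη (k : Fin 3) : mvfderiv (𝓡 3) (fun y ↦ S.η y (e k y)) x = 0 := by
    refine mvfderiv_eq_zero_of_eventuallyEq_const (c := if k = 2 then 1 else 0) ?_
    filter_upwards [he.isOpen.mem_nhds hx] with y hy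
    rw [← S.inner_ξ, ← he.frame_two, he.inner_eq y hy]
  have h := S.extDeriv_η x _ _ ((he.smooth i).mdiffAt hx) ((he.smooth j).mdiffAt hx)
  rw [extDerivOnFields, hη, hη, ← S.inner_ξ,
    mlieBracket_eq_covDeriv_sub ((he.smooth i).mdiffAt hx) ((he.smooth j).mdiffAt hx),
    inner_sub_left, ← he.frame_two] at h
  simp only [zero_apply] at h
  simp only [connectionCoeff]
  linarith

theorem connectionCoeff_self (he : IsContactFrameOn S U e) (hx : x ∈ U) (i j : Fin 3) :
    connectionCoeff e i j j x = 0 := by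
  have := he.connectionCoeff_swap hx i j j
  linarith

/-- Equivalent to `∇_ξ ξ = 0`; it comes from `φ ξ = 0`. -/
theorem connectionCoeff_two_left (he : IsContactFrameOn S U e) (hx : x ∈ U) (j : Fin 3) :
    connectionCoeff e 2 j 2 x = 0 := by
  have h := he.connectionCoeff_sub hx j 2
  rw [he.connectionCoeff_self hx, he.frame_two, S.φ_ξ, inner_zero_right] at h
  linarith

/-- The skew part of `∇ξ` on the contact plane is fixed by `dη`; the `2` is the factor in `dη = 2
g(·, φ ·)`. -/
theorem connectionCoeff_one_two_zero (he : IsContactFrameOn S U e) (hx : x ∈ U) :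
    connectionCoeff e 1 2 0 x = connectionCoeff e 0 2 1 x + 2 := by
  have h := he.connectionCoeff_sub hx 0 1
  rw [he.φ_frame_one hx, inner_neg_right, he.inner_eq x hx, if_pos rfl] at h
  have h1 := he.connectionCoeff_swap hx 1 2 0
  have h2 := he.connectionCoeff_swap hx 0 2 1
  linarith

theorem ricci_frame_eq (he : IsContactFrameOn S U e) (hx : x ∈ U) {lam γ : M → ℝ}
    (hQ : S.IsGeneralizedEtaEinsteinWith lam γ) (j k : Fin 3) :
    ∑ i, (inner ℝ (curvatureOnFields (𝓡 3) (e i) (e j) (e k) x) (e i x) : ℝ)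
      = (if j = k then lam x else 0) + (if j = 2 then if k = 2 then γ x else 0 else 0) := by
  have hη (k : Fin 3) : (inner ℝ (S.ξ x) (e k x) : ℝ) = if k = 2 then 1 else 0 := by
    rw [← he.frame_two, he.inner_eq x hx, eq_comm]
    simp only [eq_comm]
  rw [← he.ricci_frame hx, ← he.inner_ricciOperator hx, hQ.2.2, inner_add_left,
    real_inner_smul_left, real_inner_smul_left, he.inner_eq x hx, ← S.inner_ξ, real_inner_comm, hη,
    hη]
  split_ifs <;> simp

end IsContactFrameOn

end ContactFrame

/-! ### The Ricci hypothesis as first-order equations for `h` and `α` -/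

section StructureEquations

variable {M : Type*} [TopologicalSpace M] [ChartedSpace (EuclideanSpace ℝ (Fin 3)) M]
  [IsManifold (𝓡 3) ∞ M] [RiemannianBundle (fun x : M ↦ TangentSpace (𝓡 3) x)]
  {S : ContactMetricStructure M} {U V : Set M} {e : Fin 3 → Π x : M, TangentSpace (𝓡 3) x} {x : M}

namespace IsContactFrameOn

theorem mono (he : IsContactFrameOn S U e) (hV : IsOpen V) (h : V ⊆ U) : IsContactFrameOn S V e where
  toIsOrthonormalFrameOn := he.toIsOrthonormalFrameOn.mono hV h
  frame_two := he.frame_two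
  φ_frame_zero y hy := he.φ_frame_zero y (h hy)

theorem mvfderiv_congr (he : IsContactFrameOn S U e) (hx : x ∈ U) {f g : M → ℝ}
    (h : ∀ y ∈ U, f y = g y) : mvfderiv (𝓡 3) f x = mvfderiv (𝓡 3) g x := by
  refine ContactGeometry.mvfderiv_congr ?_
  filter_upwards [he.isOpen.mem_nhds hx] with y hy using h y hy

variable [IsContMDiffRiemannianBundle (𝓡 3) ∞ (EuclideanSpace ℝ (Fin 3))
      (fun x : M ↦ TangentSpace (𝓡 3) x)] {lam γ : M → ℝ}

theorem connectionCoeff_two_two (he : IsContactFrameOn S U e) (hx : x ∈ U) (k : Fin 3) :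
    connectionCoeff e 2 2 k x = 0 := by
  rw [he.connectionCoeff_swap hx 2 k 2, he.connectionCoeff_two_left hx, neg_zero]

theorem mvfderiv_connectionCoeff_self (he : IsContactFrameOn S U e) (hx : x ∈ U) (i j : Fin 3) :
    mvfderiv (𝓡 3) (connectionCoeff e i j j) x = 0 := by
  rw [he.mvfderiv_congr hx fun y hy ↦ he.connectionCoeff_self hy i j, mvfderiv_const]

theorem mvfderiv_connectionCoeff_two_left (he : IsContactFrameOn S U e) (hx : x ∈ U) (j : Fin 3) :
    mvfderiv (𝓡 3) (connectionCoeff e 2 j 2) x = 0 := by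
  rw [he.mvfderiv_congr hx fun y hy ↦ he.connectionCoeff_two_left hy j, mvfderiv_const]

theorem mvfderiv_connectionCoeff_two_two (he : IsContactFrameOn S U e) (hx : x ∈ U) (k : Fin 3) :
    mvfderiv (𝓡 3) (connectionCoeff e 2 2 k) x = 0 := by
  rw [he.mvfderiv_congr hx fun y hy ↦ he.connectionCoeff_two_two hy k, mvfderiv_const]

theorem mvfderiv_connectionCoeff_swap (he : IsContactFrameOn S U e) (hx : x ∈ U) (i j k : Fin 3) :
    mvfderiv (𝓡 3) (connectionCoeff e i k j) x = - mvfderiv (𝓡 3) (connectionCoeff e i j k) x := by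
  rw [he.mvfderiv_congr hx fun y hy ↦ he.connectionCoeff_swap hy i j k, mvfderiv_fun_neg]

theorem mvfderiv_connectionCoeff_one_two_zero (he : IsContactFrameOn S U e) (hx : x ∈ U) :
    mvfderiv (𝓡 3) (connectionCoeff e 1 2 0) x = mvfderiv (𝓡 3) (connectionCoeff e 0 2 1) x := by
  rw [he.mvfderiv_congr hx fun y hy ↦ he.connectionCoeff_one_two_zero hy,
    mvfderiv_fun_add ((he.smooth_connectionCoeff 0 2 1).mdiffAt hx) mdifferentiableAt_const,
    mvfderiv_const, add_zero]

/-- The tensor `h`, given by `∇ξ = -φ - φ h`, is trace-free. -/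
theorem connectionCoeff_one_two_one (he : IsContactFrameOn S U e) (hx : x ∈ U)
    (hQ : S.IsGeneralizedEtaEinsteinWith lam γ) :
    connectionCoeff e 1 2 1 x = - connectionCoeff e 0 2 0 x := by
  -- Both off-diagonal Ricci entries vanish by hypothesis. In their difference the derivatives
  -- cancel, since the skew part of `∇ξ` is constant, and twice the divergence of `ξ` remains.
  have h1 := he.ricci_frame_eq hx hQ 0 1
  have h2 := he.ricci_frame_eq hx hQ 1 0
  have hw := he.connectionCoeff_swap hx
  have dw := he.mvfderiv_connectionCoeff_swap hx
  simp [he.inner_curvatureOnFields hx, Fin.sum_univ_three, he.connectionCoeff_self hx,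
    he.connectionCoeff_two_left hx, he.connectionCoeff_two_two hx,
    he.mvfderiv_connectionCoeff_self hx, he.mvfderiv_connectionCoeff_two_left hx,
    hw _ 0 1, hw _ 2 0, hw _ 2 1, dw _ 0 1, dw _ 2 0,
    dw _ 2 1, he.connectionCoeff_one_two_zero hx, he.mvfderiv_connectionCoeff_one_two_zero hx]
    at h1 h2
  linear_combination (h1 - h2) / 2

theorem mvfderiv_connectionCoeff_one_two_one (he : IsContactFrameOn S U e) (hx : x ∈ U)
    (hQ : S.IsGeneralizedEtaEinsteinWith lam γ) :
    mvfderiv (𝓡 3) (connectionCoeff e 1 2 1) x = - mvfderiv (𝓡 3) (connectionCoeff e 0 2 0) x := by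
  rw [he.mvfderiv_congr hx fun y hy ↦ he.connectionCoeff_one_two_one hy hQ, mvfderiv_fun_neg]

end IsContactFrameOn

/-- The coefficient `p` of the tensor `h`, where `h e₀ = p e₀ + q e₁`. -/
def tensorDiag (e : Fin 3 → Π x : M, TangentSpace (𝓡 3) x)
    [IsContMDiffRiemannianBundle (𝓡 3) ∞ (EuclideanSpace ℝ (Fin 3))
      (fun x : M ↦ TangentSpace (𝓡 3) x)] (y : M) : ℝ := -1 - connectionCoeff e 0 2 1 y

/-- The coefficient `q` of the tensor `h`, where `h e₀ = p e₀ + q e₁`. -/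
def tensorOffDiag (e : Fin 3 → Π x : M, TangentSpace (𝓡 3) x)
    [IsContMDiffRiemannianBundle (𝓡 3) ∞ (EuclideanSpace ℝ (Fin 3))
      (fun x : M ↦ TangentSpace (𝓡 3) x)] (y : M) : ℝ := connectionCoeff e 0 2 0 y

/-- The connection form `α`, where `α(X) = g(∇_X e₀, e₁)`. -/
def connectionForm (e : Fin 3 → Π x : M, TangentSpace (𝓡 3) x)
    [IsContMDiffRiemannianBundle (𝓡 3) ∞ (EuclideanSpace ℝ (Fin 3))
      (fun x : M ↦ TangentSpace (𝓡 3) x)] (i : Fin 3) (y : M) : ℝ := connectionCoeff e i 0 1 y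

/-- The derivative of a function in the direction of a field of the frame. -/
def frameDeriv (e : Fin 3 → Π x : M, TangentSpace (𝓡 3) x) (i : Fin 3) (f : M → ℝ) (y : M) : ℝ :=
  mvfderiv (𝓡 3) f y (e i y)

namespace IsContactFrameOn

variable [IsContMDiffRiemannianBundle (𝓡 3) ∞ (EuclideanSpace ℝ (Fin 3))
      (fun x : M ↦ TangentSpace (𝓡 3) x)] {lam γ f g : M → ℝ}

theorem smooth_tensorDiag (he : IsContactFrameOn S U e) : SmoothFunOn (𝓡 3) U (tensorDiag e) :=
  (SmoothFunOn.const (-1)).sub (he.smooth_connectionCoeff 0 2 1)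

theorem smooth_tensorOffDiag (he : IsContactFrameOn S U e) :
    SmoothFunOn (𝓡 3) U (tensorOffDiag e) :=
  he.smooth_connectionCoeff 0 2 0

theorem smooth_connectionForm (he : IsContactFrameOn S U e) (i : Fin 3) :
    SmoothFunOn (𝓡 3) U (connectionForm e i) :=
  he.smooth_connectionCoeff i 0 1

theorem smooth_frameDeriv (he : IsContactFrameOn S U e) (hf : SmoothFunOn (𝓡 3) U f) (i : Fin 3) :
    SmoothFunOn (𝓡 3) U (frameDeriv e i f) :=
  he.smooth_mvfderiv hf (he.smooth i)

omit [IsContMDiffRiemannianBundle (𝓡 3) ∞ (EuclideanSpace ℝ (Fin 3))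
      (fun x : M ↦ TangentSpace (𝓡 3) x)] in
theorem frameDeriv_congr (he : IsContactFrameOn S U e) (hx : x ∈ U) (i : Fin 3)
    (h : ∀ y ∈ U, f y = g y) : frameDeriv e i f x = frameDeriv e i g x := by
  rw [frameDeriv, frameDeriv, he.mvfderiv_congr hx h]

theorem frameDeriv_tensorDiag (he : IsContactFrameOn S U e) (hx : x ∈ U) (i : Fin 3) :
    mvfderiv (𝓡 3) (connectionCoeff e 0 2 1) x (e i x) = - frameDeriv e i (tensorDiag e) x := by
  have h : mvfderiv (𝓡 3) (tensorDiag e) x = _ :=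
    mvfderiv_fun_sub mdifferentiableAt_const ((he.smooth_connectionCoeff 0 2 1).mdiffAt hx)
  rw [frameDeriv, h, mvfderiv_const]
  simp

/-- The curvature equations of a generalized Eta-Einstein contact metric structure. -/
theorem structure_equations (he : IsContactFrameOn S U e) (hx : x ∈ U)
    (hQ : S.IsGeneralizedEtaEinsteinWith lam γ) :
    frameDeriv e 2 (tensorDiag e) x = 2 * connectionForm e 2 x * tensorOffDiag e x ∧
    frameDeriv e 2 (tensorOffDiag e) x = - 2 * connectionForm e 2 x * tensorDiag e x ∧
    frameDeriv e 1 (tensorDiag e) x = frameDeriv e 0 (tensorOffDiag e) x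
      + 2 * tensorDiag e x * connectionForm e 0 x + 2 * tensorOffDiag e x * connectionForm e 1 x ∧
    frameDeriv e 1 (tensorOffDiag e) x = - frameDeriv e 0 (tensorDiag e) x
      + 2 * tensorOffDiag e x * connectionForm e 0 x - 2 * tensorDiag e x * connectionForm e 1 x ∧
    frameDeriv e 0 (connectionForm e 2) x - frameDeriv e 2 (connectionForm e 0) x
      = tensorOffDiag e x * connectionForm e 0 x
        - (1 + tensorDiag e x + connectionForm e 2 x) * connectionForm e 1 x ∧
    frameDeriv e 1 (connectionForm e 2) x - frameDeriv e 2 (connectionForm e 1) x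
      = (1 - tensorDiag e x + connectionForm e 2 x) * connectionForm e 0 x
        - tensorOffDiag e x * connectionForm e 1 x ∧
    frameDeriv e 0 (connectionForm e 1) x - frameDeriv e 1 (connectionForm e 0) x
      = - connectionForm e 0 x ^ 2 - connectionForm e 1 x ^ 2 + 2 * connectionForm e 2 x - lam x ∧
    lam x + γ x = 2 * (1 - tensorDiag e x ^ 2 - tensorOffDiag e x ^ 2) := by
  have hR (j k : Fin 3) := he.ricci_frame_eq hx hQ j k
  have hw := he.connectionCoeff_swap hx
  have dw := he.mvfderiv_connectionCoeff_swap hx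
  have hP : connectionCoeff e 0 2 1 x = -1 - tensorDiag e x := by rw [tensorDiag]; ring
  have hq : connectionCoeff e 0 2 0 x = tensorOffDiag e x := rfl
  have hα (i : Fin 3) : connectionCoeff e i 0 1 x = connectionForm e i x := rfl
  have dq (i : Fin 3) : mvfderiv (𝓡 3) (connectionCoeff e 0 2 0) x (e i x)
    = frameDeriv e i (tensorOffDiag e) x := rfl
  have dα (i j : Fin 3) : mvfderiv (𝓡 3) (connectionCoeff e i 0 1) x (e j x)
    = frameDeriv e j (connectionForm e i) x := rfl
  have h00 := hR 0 0
  have h01 := hR 0 1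
  have h02 := hR 0 2
  have h11 := hR 1 1
  have h12 := hR 1 2
  have h20 := hR 2 0
  have h21 := hR 2 1
  have h22 := hR 2 2
  simp only [he.inner_curvatureOnFields hx, Fin.sum_univ_three, he.connectionCoeff_self hx,
    he.connectionCoeff_two_left hx, he.connectionCoeff_two_two hx,
    he.mvfderiv_connectionCoeff_self hx, he.mvfderiv_connectionCoeff_two_left hx,
    he.mvfderiv_connectionCoeff_two_two hx, hw _ 0 1, hw _ 2 0, hw _ 2 1, dw _ 0 1, dw _ 2 0,
    dw _ 2 1, he.connectionCoeff_one_two_zero hx, he.mvfderiv_connectionCoeff_one_two_zero hx,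
    he.connectionCoeff_one_two_one hx hQ, he.mvfderiv_connectionCoeff_one_two_one hx hQ, zero_apply,
    neg_apply, he.frameDeriv_tensorDiag hx, hP, hq, hα, dq, dα]
    at h00 h01 h02 h11 h12 h20 h21 h22
  simp at h00 h01 h02 h11 h12 h20 h21 h22
  -- With `f = p + i q` and `D = d + 2 i α`: the entry `Ric(e₀, e₁)` and the difference `Ric(e₁, e₁)
  -- - Ric(e₀, e₀)` give `D_ξ f = 0`; `Ric(e_i, ξ)` gives the Codazzi pair `D₁ f = -i D₀ f`; `Ric(ξ,
  -- e_i)`, with the slots exchanged, gives the vanishing of `dα` on planes containing `ξ`; `Ric(e₀,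
  -- e₀) + Ric(e₁, e₁)` gives `dα(e₀, e₁) = -lam`; `Ric(ξ, ξ)` gives `2 - tr h²`.
  refine ⟨?_, ?_, ?_, ?_, ?_, ?_, ?_, ?_⟩
  · linear_combination h01
  · linear_combination (h11 - h00) / 2
  · linear_combination -h02
  · linear_combination -h12
  · linear_combination -h21
  · linear_combination h20
  · linear_combination -(h11 + h00) / 2
  · linear_combination -h22

end IsContactFrameOn

end StructureEquations

/-! ### Rigidity where `h` does not vanish -/

section LocalRigidity

variable {M : Type*} [TopologicalSpace M] [ChartedSpace (EuclideanSpace ℝ (Fin 3)) M]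
  {U : Set M} {e : Fin 3 → Π x : M, TangentSpace (𝓡 3) x} {x : M} {lam γ f g : M → ℝ}

theorem frameDeriv_add (hf : SmoothFunOn (𝓡 3) U f) (hg : SmoothFunOn (𝓡 3) U g) (hx : x ∈ U)
    (i : Fin 3) : frameDeriv e i (fun y ↦ f y + g y) x = frameDeriv e i f x + frameDeriv e i g x := by
  rw [frameDeriv, mvfderiv_fun_add (hf.mdiffAt hx) (hg.mdiffAt hx), add_apply]
  rfl

theorem frameDeriv_sub (hf : SmoothFunOn (𝓡 3) U f) (hg : SmoothFunOn (𝓡 3) U g) (hx : x ∈ U)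
    (i : Fin 3) : frameDeriv e i (fun y ↦ f y - g y) x = frameDeriv e i f x - frameDeriv e i g x := by
  rw [frameDeriv, mvfderiv_fun_sub (hf.mdiffAt hx) (hg.mdiffAt hx), sub_apply]
  rfl

theorem frameDeriv_mul (hf : SmoothFunOn (𝓡 3) U f) (hg : SmoothFunOn (𝓡 3) U g) (hx : x ∈ U)
    (i : Fin 3) : frameDeriv e i (fun y ↦ f y * g y) x
      = f x * frameDeriv e i g x + g x * frameDeriv e i f x := by
  rw [frameDeriv, mvfderiv_fun_mul (hf.mdiffAt hx) (hg.mdiffAt hx)]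
  rfl

theorem frameDeriv_const_mul_mul (hf : SmoothFunOn (𝓡 3) U f) (hg : SmoothFunOn (𝓡 3) U g)
    (hx : x ∈ U) (i : Fin 3) (c : ℝ) : frameDeriv e i (fun y ↦ c * f y * g y) x
      = c * (f x * frameDeriv e i g x + g x * frameDeriv e i f x) := by
  rw [frameDeriv_mul ((SmoothFunOn.const c).mul hf) hg hx, frameDeriv_mul (.const c) hf hx]
  have : frameDeriv e i (fun _ ↦ c) x = 0 := by rw [frameDeriv, mvfderiv_const, zero_apply]
  rw [this]
  ring

variable [IsManifold (𝓡 3) ∞ M] [RiemannianBundle (fun x : M ↦ TangentSpace (𝓡 3) x)]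
  {S : ContactMetricStructure M}

namespace IsContactFrameOn

variable [IsContMDiffRiemannianBundle (𝓡 3) ∞ (EuclideanSpace ℝ (Fin 3))
      (fun x : M ↦ TangentSpace (𝓡 3) x)]

/-- The coefficients of `[e₀, ξ]` are those of the fifth structure equation, which therefore says
`dα(e₀, ξ) = 0`. -/
theorem frameDeriv_comm_zero_two (he : IsContactFrameOn S U e) (hx : x ∈ U)
    (hf : SmoothFunOn (𝓡 3) U f) :
    frameDeriv e 0 (frameDeriv e 2 f) x - frameDeriv e 2 (frameDeriv e 0 f) x
      = tensorOffDiag e x * frameDeriv e 0 f x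
        - (1 + tensorDiag e x + connectionForm e 2 x) * frameDeriv e 1 f x := by
  have h := he.mvfderiv_comm hx hf 0 2
  simp only [Fin.sum_univ_three, he.connectionCoeff_self hx, he.connectionCoeff_two_left hx] at h
  refine h.trans ?_
  simp only [tensorDiag, tensorOffDiag, connectionForm, frameDeriv]
  ring

theorem frameDeriv_comm_one_two (he : IsContactFrameOn S U e) (hx : x ∈ U)
    (hQ : S.IsGeneralizedEtaEinsteinWith lam γ) (hf : SmoothFunOn (𝓡 3) U f) :
    frameDeriv e 1 (frameDeriv e 2 f) x - frameDeriv e 2 (frameDeriv e 1 f) x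
      = (1 - tensorDiag e x + connectionForm e 2 x) * frameDeriv e 0 f x
        - tensorOffDiag e x * frameDeriv e 1 f x := by
  have h := he.mvfderiv_comm hx hf 1 2
  have hw := he.connectionCoeff_swap hx
  simp only [Fin.sum_univ_three, he.connectionCoeff_self hx, he.connectionCoeff_two_left hx,
    he.connectionCoeff_one_two_zero hx, he.connectionCoeff_one_two_one hx hQ, hw 2 0 1] at h
  refine h.trans ?_
  simp only [tensorDiag, tensorOffDiag, connectionForm, frameDeriv]
  ring

theorem frameDeriv_comm_zero_one (he : IsContactFrameOn S U e) (hx : x ∈ U)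
    (hf : SmoothFunOn (𝓡 3) U f) :
    frameDeriv e 0 (frameDeriv e 1 f) x - frameDeriv e 1 (frameDeriv e 0 f) x
      = - connectionForm e 0 x * frameDeriv e 0 f x - connectionForm e 1 x * frameDeriv e 1 f x
        + 2 * frameDeriv e 2 f x := by
  have h := he.mvfderiv_comm hx hf 0 1
  have hw := he.connectionCoeff_swap hx
  simp only [Fin.sum_univ_three, he.connectionCoeff_self hx, he.connectionCoeff_one_two_zero hx,
    hw 0 0 1, hw 0 2 1, hw 1 2 0] at h
  refine h.trans ?_
  simp only [connectionForm, frameDeriv]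
  ring

/-- Off the zero set of `h`, the derivative of `h` is `-2iα h` in complex notation. -/
theorem frameDeriv_zero_eq (he : IsContactFrameOn S U e) (hx : x ∈ U)
    (hQ : S.IsGeneralizedEtaEinsteinWith lam γ)
    (h0 : tensorDiag e x ^ 2 + tensorOffDiag e x ^ 2 ≠ 0) :
    frameDeriv e 0 (tensorDiag e) x = 2 * connectionForm e 0 x * tensorOffDiag e x ∧
    frameDeriv e 0 (tensorOffDiag e) x = -2 * connectionForm e 0 x * tensorDiag e x := by
  have hp := he.smooth_tensorDiag
  have hq := he.smooth_tensorOffDiag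
  have hα := he.smooth_connectionForm
  have hs (y : M) (hy : y ∈ U) := he.structure_equations hy hQ
  -- The structure equations hold on all of `U`, so they can be differentiated: `D_ξ f = 0` along
  -- `e₀` and `e₁`, the Codazzi pair along `ξ`.
  have e1 := he.frameDeriv_congr hx 0 fun y hy ↦ (hs y hy).1
  have e2 := he.frameDeriv_congr hx 1 fun y hy ↦ (hs y hy).1
  have e3 := he.frameDeriv_congr hx 0 fun y hy ↦ (hs y hy).2.1
  have e4 := he.frameDeriv_congr hx 1 fun y hy ↦ (hs y hy).2.1
  have e5 := he.frameDeriv_congr hx 2 fun y hy ↦ (hs y hy).2.2.1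
  have e6 := he.frameDeriv_congr hx 2 fun y hy ↦ (hs y hy).2.2.2.1
  rw [frameDeriv_const_mul_mul (hα 2) hq hx] at e1 e2
  rw [frameDeriv_const_mul_mul (hα 2) hp hx] at e3 e4
  have hp0 := he.smooth_frameDeriv hp 0
  have hq0 := he.smooth_frameDeriv hq 0
  have h2p := (SmoothFunOn.const (I := 𝓡 3) (U := U) 2).mul hp
  have h2q := (SmoothFunOn.const (I := 𝓡 3) (U := U) 2).mul hq
  rw [frameDeriv_add (hq0.add (h2p.mul (hα 0))) (h2q.mul (hα 1)) hx,
    frameDeriv_add hq0 (h2p.mul (hα 0)) hx, frameDeriv_const_mul_mul hp (hα 0) hx,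
    frameDeriv_const_mul_mul hq (hα 1) hx] at e5
  have hneg : frameDeriv e 2 (fun y ↦ -frameDeriv e 0 (tensorDiag e) y) x
      = - frameDeriv e 2 (frameDeriv e 0 (tensorDiag e)) x := by
    rw [frameDeriv, mvfderiv_fun_neg]
    rfl
  have hn : SmoothFunOn (𝓡 3) U (fun y ↦ -frameDeriv e 0 (tensorDiag e) y) :=
    fun y hy ↦ (hp0 y hy).neg
  rw [frameDeriv_sub (hn.add (h2q.mul (hα 0))) (h2p.mul (hα 1)) hx,
    frameDeriv_add hn (h2q.mul (hα 0)) hx, frameDeriv_const_mul_mul hq (hα 0) hx,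
    frameDeriv_const_mul_mul hp (hα 1) hx, hneg] at e6
  have c1 := he.frameDeriv_comm_zero_two hx hp
  have c2 := he.frameDeriv_comm_zero_two hx hq
  have c3 := he.frameDeriv_comm_one_two hx hQ hp
  have c4 := he.frameDeriv_comm_one_two hx hQ hq
  obtain ⟨s1, s2, s3, s4, s5, s6, -, -⟩ := hs x hx
  rw [e1] at c1
  rw [e3] at c2
  rw [e2, e5] at c3
  rw [e4, e6] at c4
  rw [sub_eq_iff_eq_add] at s5 s6
  simp only [s1, s2, s3, s4, s5, s6] at c1 c2 c3 c4
  -- The unknown derivatives `ξ e₀ p` and `ξ e₀ q` cancel in `c1 + c4` and `c3 - c2`. What is left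
  -- are the imaginary part `k1` and the real part `k2` of the conjugate of `f` times `D₀ f`;
  -- multiplying by `f` gives `|f|² D₀ f = 0`.
  have k1 : tensorDiag e x * (frameDeriv e 0 (tensorOffDiag e) x
      + 2 * connectionForm e 0 x * tensorDiag e x) - tensorOffDiag e x *
      (frameDeriv e 0 (tensorDiag e) x - 2 * connectionForm e 0 x * tensorOffDiag e x) = 0 := by
    linear_combination (c1 + c4) / 2
  have k2 : tensorDiag e x *
      (frameDeriv e 0 (tensorDiag e) x - 2 * connectionForm e 0 x * tensorOffDiag e x)
      + tensorOffDiag e x * (frameDeriv e 0 (tensorOffDiag e) x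
      + 2 * connectionForm e 0 x * tensorDiag e x) = 0 := by
    linear_combination (c3 - c2) / 2
  constructor
  · refine mul_left_cancel₀ h0 ?_
    linear_combination tensorDiag e x * k2 - tensorOffDiag e x * k1
  · refine mul_left_cancel₀ h0 ?_
    linear_combination tensorDiag e x * k1 + tensorOffDiag e x * k2

theorem isOpen_support (he : IsContactFrameOn S U e) :
    IsOpen (U ∩ {y | tensorDiag e y ^ 2 + tensorOffDiag e y ^ 2 ≠ 0}) := by
  rw [isOpen_iff_mem_nhds]
  rintro y ⟨hy, hy0⟩
  refine inter_mem (he.isOpen.mem_nhds hy) ?_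
  have hc : ContinuousAt (fun y ↦ tensorDiag e y ^ 2 + tensorOffDiag e y ^ 2) y :=
    ((he.smooth_tensorDiag y hy).continuousAt.pow 2).add
      ((he.smooth_tensorOffDiag y hy).continuousAt.pow 2)
  exact hc.eventually_ne hy0

/-- Off the zero set of `h`, the derivative of `h` is `-2iα h` in complex notation. -/
theorem frameDeriv_eq (he : IsContactFrameOn S U e) (hx : x ∈ U)
    (hQ : S.IsGeneralizedEtaEinsteinWith lam γ)
    (h0 : tensorDiag e x ^ 2 + tensorOffDiag e x ^ 2 ≠ 0) (i : Fin 3) :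
    frameDeriv e i (tensorDiag e) x = 2 * connectionForm e i x * tensorOffDiag e x ∧
    frameDeriv e i (tensorOffDiag e) x = -2 * connectionForm e i x * tensorDiag e x := by
  have h := he.frameDeriv_zero_eq hx hQ h0
  obtain ⟨s1, s2, s3, s4, -⟩ := he.structure_equations hx hQ
  -- The Codazzi pair `D₁ f = -i D₀ f` carries the vanishing from `e₀` to `e₁`.
  have h1 : frameDeriv e 1 (tensorDiag e) x = 2 * connectionForm e 1 x * tensorOffDiag e x ∧
      frameDeriv e 1 (tensorOffDiag e) x = -2 * connectionForm e 1 x * tensorDiag e x :=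
    ⟨by linear_combination s3 + h.2, by linear_combination s4 - h.1⟩
  fin_cases i
  exacts [h, h1, ⟨s1, s2⟩]

/-- Off the zero set of `h`, the coefficient `lam` vanishes. -/
theorem lam_eq_zero (he : IsContactFrameOn S U e) (hx : x ∈ U)
    (hQ : S.IsGeneralizedEtaEinsteinWith lam γ)
    (h0 : tensorDiag e x ^ 2 + tensorOffDiag e x ^ 2 ≠ 0) : lam x = 0 := by
  -- `D f = 0` is known only where `h ≠ 0`; on this open set it may be differentiated again.
  have he' := he.mono he.isOpen_support Set.inter_subset_left
  have hx' : x ∈ U ∩ {y | tensorDiag e y ^ 2 + tensorOffDiag e y ^ 2 ≠ 0} := ⟨hx, h0⟩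
  have hp := he'.smooth_tensorDiag
  have hq := he'.smooth_tensorOffDiag
  have hα := he'.smooth_connectionForm
  have hD (i j : Fin 3) : frameDeriv e j (frameDeriv e i (tensorDiag e)) x = _ :=
    he'.frameDeriv_congr hx' j fun y hy ↦ (he.frameDeriv_eq hy.1 hQ hy.2 i).1
  have hD' (i j : Fin 3) : frameDeriv e j (frameDeriv e i (tensorOffDiag e)) x = _ :=
    he'.frameDeriv_congr hx' j fun y hy ↦ (he.frameDeriv_eq hy.1 hQ hy.2 i).2
  have hf (i : Fin 3) := he.frameDeriv_eq hx hQ h0 i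
  have c1 := he'.frameDeriv_comm_zero_one hx' hp
  have c2 := he'.frameDeriv_comm_zero_one hx' hq
  rw [hD, hD, frameDeriv_const_mul_mul (hα 1) hq hx', frameDeriv_const_mul_mul (hα 0) hq hx'] at c1
  rw [hD', hD', frameDeriv_const_mul_mul (hα 1) hp hx', frameDeriv_const_mul_mul (hα 0) hp hx']
    at c2
  obtain ⟨-, -, -, -, -, -, s7, -⟩ := he.structure_equations hx hQ
  simp only [(hf _).1, (hf _).2, sub_eq_iff_eq_add.1 s7] at c1 c2
  -- The curvature of `D` on `(e₀, e₁)` annihilates the parallel section `f`; the components `c1`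
  -- and `c2` reduce to `lam q = 0` and `lam p = 0`, combined into `|f|² lam = 0`.
  refine (mul_eq_zero.1 ?_).resolve_left h0
  linear_combination tensorDiag e x * c2 / 2 - tensorOffDiag e x * c1 / 2

/-- Off the zero set of `h`, the function `lam + γ` has vanishing derivative. -/
theorem mvfderiv_add_eq_zero (he : IsContactFrameOn S U e) (hx : x ∈ U)
    (hQ : S.IsGeneralizedEtaEinsteinWith lam γ)
    (h0 : tensorDiag e x ^ 2 + tensorOffDiag e x ^ 2 ≠ 0) :
    mvfderiv (𝓡 3) (fun y ↦ lam y + γ y) x = 0 := by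
  have hp := he.smooth_tensorDiag
  have hq := he.smooth_tensorOffDiag
  have h1 : mvfderiv (𝓡 3) (fun y ↦ lam y + γ y) x = mvfderiv (𝓡 3) (fun y ↦ 2
      - 2 * tensorDiag e y * tensorDiag e y - 2 * tensorOffDiag e y * tensorOffDiag e y) x :=
    he.mvfderiv_congr hx fun y hy ↦ by
      rw [(he.structure_equations hy hQ).2.2.2.2.2.2.2]; ring
  have h2p := ((SmoothFunOn.const (I := 𝓡 3) (U := U) 2).mul hp).mul hp
  have h2q := ((SmoothFunOn.const (I := 𝓡 3) (U := U) 2).mul hq).mul hq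
  have h2 := SmoothFunOn.const (I := 𝓡 3) (U := U) 2
  -- `d|f|² = 0` because `df = -2 i α f` with `α` real.
  have h3 (i : Fin 3) : mvfderiv (𝓡 3) (fun y ↦ lam y + γ y) x (e i x) = 0 := by
    rw [h1]
    change frameDeriv e i _ x = 0
    rw [frameDeriv_sub (h2.sub h2p) h2q hx, frameDeriv_sub h2 h2p hx,
      frameDeriv_const_mul_mul hp hp hx, frameDeriv_const_mul_mul hq hq hx,
      (he.frameDeriv_eq hx hQ h0 i).1, (he.frameDeriv_eq hx hQ h0 i).2, frameDeriv, mvfderiv_const,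
      zero_apply]
    ring
  ext v
  rw [← he.sum_inner_smul x hx v, map_sum]
  simp [h3]

end IsContactFrameOn

end LocalRigidity

/-! ### Functions with vanishing derivative -/

section LocallyConstant

variable {E : Type*} [NormedAddCommGroup E] [NormedSpace ℝ E]
  {H : Type*} [TopologicalSpace H] {I : ModelWithCorners ℝ E H} [I.Boundaryless]
  {M : Type*} [TopologicalSpace M] [ChartedSpace H M] [IsManifold I ∞ M] {x : M}

/-- A function whose derivative vanishes near `x` is constant near `x`. -/
theorem eventually_eq_of_mvfderiv_eq_zero {f : M → ℝ}
    (hf : ∀ᶠ y in 𝓝 x, MDiffAt f y ∧ d% f y = 0) : ∀ᶠ y in 𝓝 x, f y = f x := by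
  set φ := extChartAt I x
  have hto : IsOpen φ.target := isOpen_extChartAt_target x
  have hx : φ x ∈ φ.target := mem_extChartAt_target x
  have hc : ContinuousAt φ.symm (φ x) := continuousAt_extChartAt_symm x
  have h1 : ∀ᶠ z in 𝓝 (φ x), MDiffAt f (φ.symm z) ∧ d% f (φ.symm z) = 0 := by
    rw [← extChartAt_to_inv (I := I) x] at hf
    exact hc.eventually hf
  obtain ⟨r, hr, hball⟩ := Metric.eventually_nhds_iff_ball.1 (h1.and (hto.mem_nhds hx))
  have hs (z : E) (hz : z ∈ Metric.ball (φ x) r) :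
      MDifferentiableAt 𝓘(ℝ, E) I φ.symm z :=
    ((contMDiffOn_extChartAt_symm (n := ∞) x).contMDiffAt
      (hto.mem_nhds (hball z hz).2)).mdifferentiableAt (by simp)
  have hd (z : E) (hz : z ∈ Metric.ball (φ x) r) : HasFDerivAt (f ∘ φ.symm) (0 : E →L[ℝ] ℝ) z := by
    have h2 := (hball z hz).1.1.comp z (hs z hz)
    have h3 := mvfderiv_comp (I := I) (I' := 𝓘(ℝ, E)) z (hball z hz).1.1 (hs z hz)
    rw [(hball z hz).1.2, ContinuousLinearMap.zero_comp] at h3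
    have h4 := h2.differentiableAt.hasFDerivAt
    have h5 : fderiv ℝ (f ∘ φ.symm) z = 0 := by
      rw [← mfderiv_eq_fderiv]
      exact h3
    rwa [h5] at h4
  have hconst (z : E) (hz : z ∈ Metric.ball (φ x) r) : f (φ.symm z) = f x := by
    have h := (convex_ball (φ x) r).is_const_of_fderivWithin_eq_zero (𝕜 := ℝ) (f := f ∘ φ.symm)
      (fun z hz ↦ (hd z hz).differentiableAt.differentiableWithinAt)
      (fun z hz ↦ by
        rw [fderivWithin_of_isOpen Metric.isOpen_ball hz]
        exact (hd z hz).fderiv) hz (Metric.mem_ball_self hr)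
    simpa [φ] using h
  filter_upwards [(continuousAt_extChartAt (I := I) x).eventually (Metric.ball_mem_nhds _ hr),
    extChartAt_source_mem_nhds (I := I) x] with y hy hys
  rw [← hconst _ hy, φ.left_inv hys]

end LocallyConstant

/-! ### The K-contact case and the scalar curvature -/

section Main

variable {M : Type*} [TopologicalSpace M] [ChartedSpace (EuclideanSpace ℝ (Fin 3)) M]
  [IsManifold (𝓡 3) ∞ M] [RiemannianBundle (fun x : M ↦ TangentSpace (𝓡 3) x)]
  [IsContMDiffRiemannianBundle (𝓡 3) ∞ (EuclideanSpace ℝ (Fin 3))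
      (fun x : M ↦ TangentSpace (𝓡 3) x)]
  {S : ContactMetricStructure M} {U : Set M} {e : Fin 3 → Π x : M, TangentSpace (𝓡 3) x} {x : M}
  {lam γ : M → ℝ}

/-- If `h` vanishes at `x`, then `∇ξ` is skew-symmetric at `x`. -/
theorem IsContactFrameOn.inner_leviCivita_ξ (he : IsContactFrameOn S U e) (hx : x ∈ U)
    (hQ : S.IsGeneralizedEtaEinsteinWith lam γ)
    (h0 : tensorDiag e x ^ 2 + tensorOffDiag e x ^ 2 = 0) (v w : TangentSpace (𝓡 3) x) :
    (inner ℝ (leviCivita (𝓡 3) M S.ξ x v) w : ℝ)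
      + inner ℝ v (leviCivita (𝓡 3) M S.ξ x w) = 0 := by
  have hp : tensorDiag e x = 0 := by nlinarith [sq_nonneg (tensorOffDiag e x)]
  have hq : connectionCoeff e 0 2 0 x = 0 := by
    change tensorOffDiag e x = 0
    nlinarith [sq_nonneg (tensorDiag e x)]
  have hP : connectionCoeff e 0 2 1 x = -1 := by rw [tensorDiag] at hp; linarith
  have hskew (i j : Fin 3) : connectionCoeff e j 2 i x = - connectionCoeff e i 2 j x := by
    have := he.connectionCoeff_self hx
    have := he.connectionCoeff_two_two hx
    have := he.connectionCoeff_one_two_zero hx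
    have := he.connectionCoeff_one_two_one hx hQ
    fin_cases i <;> fin_cases j <;> simp_all <;> norm_num
  have key (v w : TangentSpace (𝓡 3) x) : (inner ℝ (leviCivita (𝓡 3) M S.ξ x v) w : ℝ) =
      ∑ i, ∑ j, (inner ℝ (e i x) v : ℝ) * (inner ℝ (e j x) w) * connectionCoeff e i 2 j x := by
    conv_lhs => rw [← he.sum_inner_smul x hx v, ← he.sum_inner_smul x hx w]
    simp only [map_sum, map_smul, sum_inner, inner_sum, real_inner_smul_left,
      real_inner_smul_right, connectionCoeff, covDeriv, he.frame_two]
    rw [Finset.sum_comm]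
    refine Finset.sum_congr rfl fun i _ ↦ Finset.sum_congr rfl fun j _ ↦ by ring
  rw [real_inner_comm _ v, key v w, key w v, Finset.sum_comm, ← Finset.sum_add_distrib]
  refine Finset.sum_eq_zero fun i _ ↦ ?_
  rw [← Finset.sum_add_distrib]
  refine Finset.sum_eq_zero fun j _ ↦ ?_
  rw [hskew i j]
  ring

/-- The last structure equation forces `h = 0`, so `∇ξ` is skew. For a torsion-free metric
connection this is the Killing equation. -/
theorem isKContact_of_add_eq_two (hQ : S.IsGeneralizedEtaEinsteinWith lam γ)
    (h : ∀ x, lam x + γ x = 2) : S.IsKContact := by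
  intro x X Y hX hY
  obtain ⟨U, e, hx, he⟩ := exists_contactFrame S x
  have hξ : MDifferentiableAt (𝓡 3) (𝓡 3).tangent (T% S.ξ) x :=
    (S.contMDiff_ξ x).mdifferentiableAt (by simp)
  have h0 : tensorDiag e x ^ 2 + tensorOffDiag e x ^ 2 = 0 := by
    have := (he.structure_equations hx hQ).2.2.2.2.2.2.2
    linarith [h x]
  have hs := he.inner_leviCivita_ξ hx hQ h0 (X x) (Y x)
  rw [leviCivita_metric hξ hX hY, mlieBracket_eq_covDeriv_sub hξ hX,
    mlieBracket_eq_covDeriv_sub hξ hY, inner_sub_left, inner_sub_right]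
  simp only [covDeriv]
  linarith

/-- The trace of `c η ⊗ ξ` is `c |ξ|²`, by Parseval in the standard basis. -/
theorem scalarCurvature_eq (c : ℝ)
    (hQ : ∀ v : TangentSpace (𝓡 3) x, ricciOperator (𝓡 3) x v = (c * S.η x v) • S.ξ x) :
    scalarCurvature (𝓡 3) x = c := by
  obtain ⟨U, e, hx, he⟩ := exists_contactFrame S x
  have h (v : TangentSpace (𝓡 3) x) : ricci (𝓡 3) x v v
      = c * ((inner ℝ (S.ξ x) v : ℝ) * inner ℝ v (S.ξ x)) := by
    rw [← he.inner_ricciOperator hx, hQ, real_inner_smul_left, S.inner_ξ]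
    ring
  simp only [scalarCurvature, h]
  rw [← Finset.mul_sum, OrthonormalBasis.sum_inner_mul_inner, S.inner_ξ, S.η_ξ, mul_one]

end Main

end ContactGeometry

end

theorem mainTheorem1 {M : Type*} [TopologicalSpace M] [T2Space M] [SecondCountableTopology M]
    [ConnectedSpace M] [ChartedSpace (EuclideanSpace ℝ (Fin 3)) M] [IsManifold (𝓡 3) ∞ M]
    [RiemannianBundle (fun x : M ↦ TangentSpace (𝓡 3) x)]
    [IsContMDiffRiemannianBundle (𝓡 3) ∞ (EuclideanSpace ℝ (Fin 3))
      (fun x : M ↦ TangentSpace (𝓡 3) x)]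
    (S : ContactGeometry.ContactMetricStructure M) (lam γ : M → ℝ)
    (hQ : S.IsGeneralizedEtaEinsteinWith lam γ) (hK : ¬ S.IsKContact) :
    (∀ x, lam x = 0) ∧
      ∃ c : ℝ, (∀ x, γ x = c) ∧
        (∀ (x : M) (v : TangentSpace (𝓡 3) x),
          ContactGeometry.ricciOperator (𝓡 3) x v = (c * S.η x v) • S.ξ x) ∧
        ∀ x : M, ContactGeometry.scalarCurvature (𝓡 3) x = c := by
  obtain ⟨x₀, hx₀⟩ : ∃ x, lam x + γ x ≠ 2 := by
    by_contra! h
    exact hK (ContactGeometry.isKContact_of_add_eq_two hQ h)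
  have hsmooth : ContMDiff (𝓡 3) 𝓘(ℝ, ℝ) ∞ (fun y ↦ lam y + γ y) := hQ.1.add hQ.2.1
  have hloc (x : M) (hx : lam x + γ x ≠ 2) :
      lam x = 0 ∧ mvfderiv (𝓡 3) (fun y ↦ lam y + γ y) x = 0 := by
    obtain ⟨U, e, hxU, he⟩ := ContactGeometry.exists_contactFrame S x
    have h0 : ContactGeometry.tensorDiag e x ^ 2 + ContactGeometry.tensorOffDiag e x ^ 2 ≠ 0 := by
      have := (he.structure_equations hxU hQ).2.2.2.2.2.2.2
      intro h
      exact hx (by linarith)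
    exact ⟨he.lam_eq_zero hxU hQ h0, he.mvfderiv_add_eq_zero hxU hQ h0⟩
  -- The level value differs from `2`, so near any point of the level set `h ≠ 0` and `lam + γ` has
  -- zero derivative; hence the set is open.
  have hclopen : IsClopen {x | lam x + γ x = lam x₀ + γ x₀} := by
    refine ⟨isClosed_eq hsmooth.continuous continuous_const, isOpen_iff_mem_nhds.2 fun x hx ↦ ?_⟩
    have hne : ∀ᶠ y in nhds x, lam y + γ y ≠ 2 :=
      hsmooth.continuous.continuousAt.eventually_ne (by rwa [hx.out])
    filter_upwards [ContactGeometry.eventually_eq_of_mvfderiv_eq_zero (I := 𝓡 3)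
      (hne.mono fun y hy ↦ ⟨(hsmooth y).mdifferentiableAt (by simp), (hloc y hy).2⟩)] with y hy
    exact hy.trans hx
  have hconst (x : M) : lam x + γ x = lam x₀ + γ x₀ := by
    exact Set.eq_univ_iff_forall.1 (hclopen.eq_univ ⟨x₀, rfl⟩) x
  -- Now `lam + γ` avoids `2` everywhere, so the local result applies at every point.
  have hlam (x : M) : lam x = 0 := (hloc x (by rwa [hconst])).1
  have hγ (x : M) : γ x = γ x₀ := by simpa [hlam] using hconst x
  have hric (x : M) (v : TangentSpace (𝓡 3) x) :
      ContactGeometry.ricciOperator (𝓡 3) x v = (γ x₀ * S.η x v) • S.ξ x := by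
    rw [hQ.2.2 x v, hlam, hγ, zero_smul, zero_add]
  exact ⟨hlam, γ x₀, hγ, hric, fun x ↦ ContactGeometry.scalarCurvature_eq (γ x₀) (hric x)⟩
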